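/- Let $X$ and $S$ be finite sets. An $(X,S)$-graph is a simple graph whose vertices are colored by $X$ and whose directed edges are colored by $S$ (the two orientations of an edge are colored separately). Let $G$ be an infinite connected $(X,S)$-graph with all vertex degrees at most $d$. For a finite set $W\subset V(G)$ let $\partial W$ be the set of vertices of $W$ that have a neighbor in $G$ outside $W$. A Følner sequence of $G$ is a sequence $\{G_n\}$ of finite connected spanned (induced) subgraphs of $G$ with $|\partial V(G_n)|/|V(G_n)|\to 0$. Suppose that $G$ is amenable, i.e. has a Følner sequence, and that every Følner sequence $\{G_n\}$ of $G$ has the following two properties. (a) (Uniform patch frequency.) $\{G_n\}$ is weakly convergent: $|V(G_n)|\to\infty$, and for every $r\ge 1$ and every finite connected rooted $(X,S)$-graph $\alpha$ with degrees at most $d$ and all vertices at distance at most $r$ from the root, the proportion of the vertices $z\in V(G_n)$ whose $r$-neighborhood in $G_n$, rooted at $z$, is isomorphic to $\alpha$ as a rooted colored graph converges as $n\to\infty$. (b) $\{G_n\}$ is an antiexpander: for every $\varepsilon>0$ there is $K_\varepsilon>0$ such that for every $n$ one can remove at most $\varepsilon|E(G_n)|$ edges from $G_n$ so that every component of the remaining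 graph has at most $K_\varepsilon$ vertices. Let $A:V(G)\times V(G)\to\mathbb R$ be the kernel of a self-adjoint (i.e. $A(x,y)=A(y,x)$) finite range pattern-invariant operator: there is $s\in\mathbb N$ such that $A(x,y)=0$ whenever $d_G(x,y)>s$, and such that $A(x,y)=A(\phi(x),\phi(y))$ whenever $\phi:B_s(x)\to B_s(x')$ is an isomorphism of the (spanned, colored) $s$-neighborhoods of two vertices $x$ and $x'$ with $\phi(x)=x'$, and $y\in B_s(x)$. For a Følner sequence $\{G_n\}$ let $A_n$ be the restriction of $A$ to $V(G_n)\times V(G_n)$ and let $$N_{A_n}(\lambda)=\frac{|\{\text{eigenvalues of }A_n\text{ not larger than }\lambda\text{, with multiplicities}\}|}{|V(G_n)|}.$$ Then there is a monotone right-continuous function $\sigma_A:\mathbb R\to\mathbb R$ (the integrated density of states), independent of the Følner sequence, such that for every Følner sequence $\{G_n\}$ of $G$ the functions $N_{A_n}$ converge to $\sigma_A$ uniformly on $\mathbb R$. -/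

import Mathlib

open Filter Topology

/-- A simple graph on `V` whose vertices are colored by `X` and whose directed edges are colored
by `S` (the two orientations of an edge are colored separately). -/
structure XSGraph (V X S : Type*) where
  graph : SimpleGraph V
  vertexColor : V → X
  edgeColor : ∀ x y : V, graph.Adj x y → S

namespace XSGraph

variable {V V' X S : Type*}

/-- The subgraph spanned by a set of vertices, with the inherited coloring. -/
def induce (G : XSGraph V X S) (W : Set V) : XSGraph W X S where
  graph := G.graph.induce W
  vertexColor x := G.vertexColor x
  edgeColor x y h := G.edgeColor x y h

/-- The isomorphisms of graphs that take the root `x` to the root `y` and preserve the colors of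
the vertices and of the directed edges. -/
structure RootedIso (G : XSGraph V X S) (x : V) (H : XSGraph V' X S) (y : V') where
  iso : G.graph ≃g H.graph
  map_root : iso x = y
  vertexColor_map : ∀ v, H.vertexColor (iso v) = G.vertexColor v
  edgeColor_map : ∀ (u v : V) (h : G.graph.Adj u v),
    H.edgeColor (iso u) (iso v) (iso.map_adj_iff.2 h) = G.edgeColor u v h

/-- The vertices at shortest path distance at most `r` from `x`. -/
def ballSet (G : XSGraph V X S) (x : V) (r : ℕ) : Set V :=
  {y | G.graph.edist x y ≤ r}

/-- The root of the ball, as one of its vertices. -/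
def ballRoot (G : XSGraph V X S) (x : V) (r : ℕ) : G.ballSet x r :=
  ⟨x, by simp [ballSet]⟩

/-- The `r`-neighborhood of `x`: the subgraph spanned by the ball, with the inherited coloring. -/
def ball (G : XSGraph V X S) (x : V) (r : ℕ) : XSGraph (G.ballSet x r) X S :=
  G.induce (G.ballSet x r)

/-- All vertex degrees are at most `d`. -/
def DegreeBound (G : XSGraph V X S) (d : ℕ) : Prop :=
  ∀ x, (G.graph.neighborSet x).encard ≤ d

/-- A finite colored graph `α` with root `o` is a rooted `(d, r, X, S)`-graph. -/
structure IsRootedPattern [Finite V] (d r : ℕ) (α : XSGraph V X S) (o : V) : Prop where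
  connected : α.graph.Connected
  degreeBound : α.DegreeBound d
  radius : ∀ z, α.graph.edist o z ≤ r

/-- The proportion `p_G(α)` of the vertices of the finite graph `G` whose `r`-neighborhood is
rooted isomorphic to `(α, o)`. -/
noncomputable def patternFrequency [Fintype V] (G : XSGraph V X S) (r : ℕ)
    (α : XSGraph V' X S) (o : V') : ℝ :=
  ({z : V | Nonempty (RootedIso (G.ball z r) (G.ballRoot z r) α o)}.ncard : ℝ) / Fintype.card V

/-- Weak convergence of a sequence of finite `(X, S)`-graphs of degree bound `d`. Each rooted
isomorphism class of rooted `(d, r, X, S)`-graphs has a representative with vertex set `Fin m`. -/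
def WeaklyConvergent (d : ℕ) {U : ℕ → Type*} [∀ n, Fintype (U n)]
    (G : ∀ n, XSGraph (U n) X S) : Prop :=
  Tendsto (fun n => Fintype.card (U n)) atTop atTop ∧
    ∀ (r : ℕ), 1 ≤ r → ∀ (m : ℕ) (α : XSGraph (Fin m) X S) (o : Fin m),
      IsRootedPattern d r α o →
        ∃ p : ℝ, Tendsto (fun n => (G n).patternFrequency r α o) atTop (𝓝 p)

/-- A sequence of finite graphs is an antiexpander (is hyperfinite) if for each `ε > 0` there is
a `K` such that from each graph one can remove at most `ε |E|` edges in such a way that all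
components of the remaining graph have at most `K` vertices. -/
def Antiexpander {U : ℕ → Type*} [∀ n, Fintype (U n)] (G : ∀ n, XSGraph (U n) X S) : Prop :=
  ∀ ε : ℝ, 0 < ε → ∃ K : ℕ, 0 < K ∧ ∀ n, ∃ F : Set (Sym2 (U n)),
    F ⊆ (G n).graph.edgeSet ∧
    (F.ncard : ℝ) ≤ ε * ((G n).graph.edgeSet.ncard : ℝ) ∧
    ∀ c : ((G n).graph.deleteEdges F).ConnectedComponent, c.supp.ncard ≤ K

/-- The boundary of the subgraph spanned by `W`: the vertices of `W` with a neighbor (in `G`)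
outside `W`. -/
def boundary (G : XSGraph V X S) (W : Set V) : Set V :=
  {x | x ∈ W ∧ ∃ y, y ∉ W ∧ G.graph.Adj x y}

/-- A Følner sequence: finite connected spanned subgraphs (given by their vertex sets, and
non-empty because they are connected) with `|∂ W n| / |W n| → 0`. -/
structure IsFolnerSequence (G : XSGraph V X S) (W : ℕ → Finset V) : Prop where
  connected : ∀ n, (G.graph.induce (W n : Set V)).Connected
  tendsto_boundary :
    Tendsto (fun n => ((G.boundary (W n)).ncard : ℝ) / ((W n).card : ℝ)) atTop (𝓝 0)

/-- The sequence of finite `(X, S)`-graphs spanned by the sets `W n`. -/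
def inducedSequence (G : XSGraph V X S) (W : ℕ → Finset V) (n : ℕ) :
    XSGraph (W n : Set V) X S :=
  G.induce (W n : Set V)

/-- A graph is amenable if it has a Følner sequence. -/
def Amenable (G : XSGraph V X S) : Prop :=
  ∃ W : ℕ → Finset V, G.IsFolnerSequence W

/-- Uniform patch frequency, for a graph of degree bound `d`: the graph is amenable, and all its
Følner sequences are weakly convergent. -/
def UniformPatchFrequency (d : ℕ) (G : XSGraph V X S) : Prop :=
  G.Amenable ∧
    ∀ W : ℕ → Finset V, G.IsFolnerSequence W → WeaklyConvergent d (G.inducedSequence W)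

/-- A finite range pattern-invariant operator, given by its kernel `A`. -/
def IsPatternInvariant (G : XSGraph V X S) (A : Matrix V V ℝ) : Prop :=
  ∃ s : ℕ,
    (∀ x y, (s : ℕ∞) < G.graph.edist x y → A x y = 0) ∧
    ∀ (x x' : V) (φ : RootedIso (G.ball x s) (G.ballRoot x s) (G.ball x' s) (G.ballRoot x' s))
      (y : G.ballSet x s), A x y = A x' (φ.iso y)

end XSGraph

open Classical in
/-- The normalized spectral distribution function of a self-adjoint matrix: the number of
eigenvalues (with multiplicities) not larger than `t`, divided by the size of the matrix. -/
noncomputable def normalizedSpectralDistribution {ι : Type*} [Fintype ι] {M : Matrix ι ι ℝ}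
    (hM : M.IsHermitian) (t : ℝ) : ℝ :=
  ((Finset.univ.filter fun i => hM.eigenvalues i ≤ t).card : ℝ) / Fintype.card ι

/-- The finite volume approximation of the operator with kernel `A` on the finite set `W`. -/
def finiteVolume {V : Type*} (A : Matrix V V ℝ) (W : Finset V) :
    Matrix (W : Set V) (W : Set V) ℝ :=
  A.submatrix (fun x => (x : V)) (fun x => (x : V))

theorem finiteVolume_isHermitian {V : Type*} {A : Matrix V V ℝ} (hA : A.IsHermitian)
    (W : Finset V) : (finiteVolume A W).IsHermitian :=
  hA.submatrix _

/-!
The spectral distribution functions `N_n` of the finite volume approximations `A_n` are shown to be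
uniformly Cauchy along each Følner sequence. Two facts are combined.

*Moments.* The trace of `A_n ^ k` is, up to a contribution of the vertices close to the boundary,
the sum over the vertices of the diagonal entries of the `k`-th power of the kernel `A` on the whole
graph. This power is again a pattern-invariant kernel of finite range
(`XSGraph.IsLocalKernel.kernelPow`), so that its diagonal entry at a vertex depends only on the
pattern around the vertex. There are finitely many patterns of a given radius, and their frequencies
converge; hence the normalized traces converge
(`XSGraph.IsFolnerSequence.exists_tendsto_trace_pow`), and by the theorem of Weierstrass so do the
averages of every continuous function over the eigenvalues.

*Atoms.* The kernel has finitely many values. Cut `A_n` at the vertices near the boundary and near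
the edges removed by the antiexpander property. The result is block diagonal with blocks of bounded
size and with entries in a finite set, so its eigenvalues lie in a finite set `Λ` that does not
depend on `n`. The cut changes the quadratic form only on vectors that do not vanish on a small set
of vertices, so by the min-max principle (`Matrix.IsHermitian.card_eigenvalues_le_le`) it changes
the distribution function only by a small uniform error. Thus `N_n` is almost constant on the
gaps of `Λ` (`XSGraph.IsFolnerSequence.exists_finset_gap`).

On each of the finitely many gaps `N_n` is therefore close to the average of one continuous test
function, and these averages converge (`exists_tendstoUniformly_empiricalCDF`). Two Følner sequences
have the same limit because their alternating sequence is a Følner sequence too.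
-/

/-! ### Balls and walks -/

namespace SimpleGraph

variable {V : Type*} {G : SimpleGraph V}

theorem exists_walk_length_le_of_edist_le {x y : V} {n : ℕ} (h : G.edist x y ≤ n) :
    ∃ p : G.Walk x y, p.length ≤ n := by
  have hne : G.edist x y ≠ ⊤ := fun ht => by simp [ht] at h
  obtain ⟨p, hp⟩ := exists_walk_of_edist_ne_top hne
  refine ⟨p, ?_⟩
  rw [← hp] at h
  exact_mod_cast h

theorem edist_le_succ_cases {x y : V} {n : ℕ} (h : G.edist x y ≤ (n + 1 : ℕ)) :
    G.edist x y ≤ n ∨ ∃ z, G.edist x z ≤ n ∧ G.Adj z y := by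
  obtain ⟨p, hp⟩ := exists_walk_length_le_of_edist_le h
  by_cases hnil : p.Nil
  · left
    obtain rfl := hnil.eq
    simp
  · right
    refine ⟨p.penultimate, ?_, p.adj_penultimate hnil⟩
    refine (edist_le p.dropLast).trans ?_
    have : p.dropLast.length + 1 = p.length := by
      rw [Walk.length_dropLast_add_one hnil]
    exact_mod_cast (by omega : p.dropLast.length ≤ n)

theorem edist_le_add {x y z : V} {a b c : ℕ} (hxy : G.edist x y ≤ a) (hyz : G.edist y z ≤ b)
    (h : a + b ≤ c) : G.edist x z ≤ c :=
  (SimpleGraph.edist_triangle (v := y)).trans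
    ((add_le_add hxy hyz).trans (by exact_mod_cast h))

theorem Walk.length_induce {x y : V} (p : G.Walk x y) {W : Set V} (h : ∀ z ∈ p.support, z ∈ W) :
    (p.induce W h).length = p.length := by
  have h' := congrArg List.length (p.support_induce h)
  rw [List.length_attachWith, length_support, length_support] at h'
  exact Nat.succ_injective h'

theorem edist_le_of_mem_support {x y z : V} (p : G.Walk x y) (hz : z ∈ p.support) :
    G.edist x z ≤ p.length := by
  classical
  refine (edist_le (p.takeUntil z hz)).trans ?_
  exact_mod_cast p.length_takeUntil_le_length hz

end SimpleGraph

namespace XSGraph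

variable {V V' V'' X S : Type*}

theorem mem_ballSet {G : XSGraph V X S} {x y : V} {r : ℕ} :
    y ∈ G.ballSet x r ↔ G.graph.edist x y ≤ r := Iff.rfl

theorem self_mem_ballSet (G : XSGraph V X S) (x : V) (r : ℕ) : x ∈ G.ballSet x r :=
  (G.ballRoot x r).2

theorem mem_ballSet_comm {G : XSGraph V X S} {x y : V} {r : ℕ} :
    y ∈ G.ballSet x r ↔ x ∈ G.ballSet y r := by
  rw [mem_ballSet, mem_ballSet, SimpleGraph.edist_comm]

theorem ballSet_mono (G : XSGraph V X S) (x : V) {r s : ℕ} (h : r ≤ s) :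
    G.ballSet x r ⊆ G.ballSet x s :=
  fun _ hy => le_trans (mem_ballSet.1 hy) (by exact_mod_cast h)

theorem DegreeBound.encard_ballSet_le {G : XSGraph V X S} {d : ℕ} (hG : G.DegreeBound d)
    (x : V) (r : ℕ) : (G.ballSet x r).encard ≤ ((d + 1) ^ r : ℕ) := by
  induction r with
  | zero =>
    have : G.ballSet x 0 ⊆ {x} := by
      intro y hy
      have h0 : G.graph.edist x y = 0 := by simpa [mem_ballSet] using hy
      exact (SimpleGraph.edist_eq_zero_iff.1 h0).symm
    simpa using Set.encard_le_encard this
  | succ r ih =>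
    have hfin : (G.ballSet x r).Finite := Set.finite_of_encard_le_coe ih
    have hcover : G.ballSet x (r + 1) ⊆
        ⋃ z ∈ hfin.toFinset, insert z (G.graph.neighborSet z) := by
      intro y hy
      simp only [Set.mem_iUnion, Set.Finite.mem_toFinset]
      rcases SimpleGraph.edist_le_succ_cases hy with h | ⟨z, hz, hzy⟩
      · exact ⟨y, h, Set.mem_insert _ _⟩
      · exact ⟨z, hz, Set.mem_insert_of_mem _ hzy⟩
    have hins : ∀ z, (insert z (G.graph.neighborSet z)).encard ≤ ((d + 1 : ℕ) : ℕ∞) := fun z =>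
      (Set.encard_insert_le _ _).trans (by push_cast; gcongr; exact hG z)
    have hfin' : ∀ z, (insert z (G.graph.neighborSet z)).Finite := fun z =>
      Set.finite_of_encard_le_coe (hins z)
    have hins' : ∀ z, (insert z (G.graph.neighborSet z)).ncard ≤ d + 1 := fun z => by
      have := hins z
      rw [← (hfin' z).cast_ncard_eq] at this
      exact_mod_cast this
    have hUfin : (⋃ z ∈ hfin.toFinset, insert z (G.graph.neighborSet z)).Finite :=
      hfin.toFinset.finite_toSet.biUnion fun z _ => hfin' z
    refine (Set.encard_le_encard hcover).trans ?_
    rw [← hUfin.cast_ncard_eq]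
    have h1 : (⋃ z ∈ hfin.toFinset, insert z (G.graph.neighborSet z)).ncard
        ≤ hfin.toFinset.card * (d + 1) := by
      refine (Finset.set_ncard_biUnion_le _ _).trans ?_
      exact Finset.sum_le_card_nsmul _ _ _ fun z _ => hins' z
    have h2 : hfin.toFinset.card ≤ (d + 1) ^ r := by
      rw [← Set.ncard_eq_toFinset_card _ hfin]
      rw [← hfin.cast_ncard_eq] at ih
      exact_mod_cast ih
    exact_mod_cast h1.trans (by rw [pow_succ]; gcongr)

theorem DegreeBound.finite_ballSet {G : XSGraph V X S} {d : ℕ} (hG : G.DegreeBound d)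
    (x : V) (r : ℕ) : (G.ballSet x r).Finite :=
  Set.finite_of_encard_le_coe (hG.encard_ballSet_le x r)

theorem DegreeBound.ncard_ballSet_le {G : XSGraph V X S} {d : ℕ} (hG : G.DegreeBound d)
    (x : V) (r : ℕ) : (G.ballSet x r).ncard ≤ (d + 1) ^ r := by
  have := hG.encard_ballSet_le x r
  rw [← (hG.finite_ballSet x r).cast_ncard_eq] at this
  exact_mod_cast this

/-- The `r`-neighborhood of a finite set has at most `(d + 1) ^ r` times as many vertices. -/
theorem DegreeBound.ncard_thickening_le {G : XSGraph V X S} {d : ℕ} (hG : G.DegreeBound d)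
    {B : Set V} (hB : B.Finite) (r : ℕ) :
    {x | ∃ z ∈ G.ballSet x r, z ∈ B}.Finite ∧
      {x | ∃ z ∈ G.ballSet x r, z ∈ B}.ncard ≤ B.ncard * (d + 1) ^ r := by
  have hcover : {x | ∃ z ∈ G.ballSet x r, z ∈ B} ⊆ ⋃ z ∈ hB.toFinset, G.ballSet z r := by
    rintro x ⟨z, hz, hzB⟩
    simp only [Set.mem_iUnion, Set.Finite.mem_toFinset]
    exact ⟨z, hzB, mem_ballSet_comm.1 hz⟩
  have hUfin : (⋃ z ∈ hB.toFinset, G.ballSet z r).Finite :=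
    hB.toFinset.finite_toSet.biUnion fun z _ => hG.finite_ballSet z r
  refine ⟨hUfin.subset hcover, (Set.ncard_le_ncard hcover hUfin).trans ?_⟩
  refine (Finset.set_ncard_biUnion_le _ _).trans ?_
  rw [Set.ncard_eq_toFinset_card _ hB]
  exact Finset.sum_le_card_nsmul _ _ _ fun z _ => hG.ncard_ballSet_le z r

/-- A walk that starts in `W` and avoids the boundary of `W` stays in `W`. -/
theorem mem_of_mem_support {G : XSGraph V X S} {W : Set V} {x y : V} (p : G.graph.Walk x y)
    (hx : x ∈ W) (hp : ∀ z ∈ p.support, z ∉ G.boundary W) : ∀ z ∈ p.support, z ∈ W := by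
  induction p with
  | nil => simpa using hx
  | @cons u v w huv p ih =>
    intro z hz
    rw [SimpleGraph.Walk.support_cons, List.mem_cons] at hz
    have hv : v ∈ W := by
      by_contra hv
      exact hp u (by simp) ⟨hx, v, hv, huv⟩
    rcases hz with rfl | hz
    · exact hx
    · exact ih hv (fun z hz => hp z (by simp [hz])) z hz

/-- If the `r`-ball of `x ∈ W` avoids the boundary of `W`, it lies in `W`, and the distances from
`x` in the spanned subgraph are the same as in `G`, up to `r`. -/
theorem exists_walk_induce {G : XSGraph V X S} {W : Set V} {x y : V} {r : ℕ} (hx : x ∈ W)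
    (hB : ∀ z ∈ G.ballSet x r, z ∉ G.boundary W) (hy : y ∈ G.ballSet x r) :
    ∃ hyW : y ∈ W, ∃ p : (G.graph.induce W).Walk ⟨x, hx⟩ ⟨y, hyW⟩, p.length ≤ r ∧
      ∀ z ∈ p.support, (z : V) ∈ G.ballSet x r := by
  obtain ⟨p, hp⟩ := SimpleGraph.exists_walk_length_le_of_edist_le hy
  have hball : ∀ z ∈ p.support, z ∈ G.ballSet x r := fun z hz =>
    (SimpleGraph.edist_le_of_mem_support p hz).trans (by exact_mod_cast hp)
  have hW := mem_of_mem_support p hx fun z hz => hB z (hball z hz)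
  refine ⟨hW y p.end_mem_support, p.induce W hW, ?_, ?_⟩
  · rwa [p.length_induce hW]
  · intro z hz
    rw [SimpleGraph.Walk.support_induce, List.mem_attachWith] at hz
    exact hball _ hz

/-! ### Rooted isomorphisms of balls -/

theorem edgeColor_congr (G : XSGraph V X S) {u v u' v' : V} (hu : u = u') (hv : v = v')
    (h : G.graph.Adj u v) (h' : G.graph.Adj u' v') : G.edgeColor u v h = G.edgeColor u' v' h' := by
  subst hu hv; rfl

namespace RootedIso

/-- The composition of rooted isomorphisms. -/
def trans {G : XSGraph V X S} {H : XSGraph V' X S} {K : XSGraph V'' X S} {x : V} {y : V'} {z : V''}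
    (φ : RootedIso G x H y) (ψ : RootedIso H y K z) : RootedIso G x K z where
  iso := φ.iso.trans ψ.iso
  map_root := by simp [φ.map_root, ψ.map_root]
  vertexColor_map v := by simp [φ.vertexColor_map, ψ.vertexColor_map]
  edgeColor_map u v h := by
    rw [← φ.edgeColor_map u v h, ← ψ.edgeColor_map]
    rfl

/-- The inverse of a rooted isomorphism. -/
def symm {G : XSGraph V X S} {H : XSGraph V' X S} {x : V} {y : V'}
    (φ : RootedIso G x H y) : RootedIso H y G x where
  iso := φ.iso.symm
  map_root := φ.iso.symm_apply_eq.2 φ.map_root.symm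
  vertexColor_map v := by rw [← φ.vertexColor_map]; simp
  edgeColor_map u v h := by
    rw [← φ.edgeColor_map]
    exact edgeColor_congr H (by simp) (by simp) _ _

end RootedIso

/-- The map `f` restricts to a rooted isomorphism of the `r`-ball of `x` onto the `r`-ball of
`x'`; its values outside the ball are irrelevant. -/
structure LocalIso (G : XSGraph V X S) (x x' : V) (r : ℕ) (f : V → V) : Prop where
  bijOn : Set.BijOn f (G.ballSet x r) (G.ballSet x' r)
  map_root : f x = x'
  adj_iff : ∀ u ∈ G.ballSet x r, ∀ v ∈ G.ballSet x r,
    G.graph.Adj (f u) (f v) ↔ G.graph.Adj u v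
  vertexColor_map : ∀ u ∈ G.ballSet x r, G.vertexColor (f u) = G.vertexColor u
  edgeColor_map : ∀ u ∈ G.ballSet x r, ∀ v ∈ G.ballSet x r, ∀ (h : G.graph.Adj u v)
    (h' : G.graph.Adj (f u) (f v)), G.edgeColor (f u) (f v) h' = G.edgeColor u v h

theorem RootedIso.exists_localIso {G : XSGraph V X S} {x x' : V} {r : ℕ}
    (φ : RootedIso (G.ball x r) (G.ballRoot x r) (G.ball x' r) (G.ballRoot x' r)) :
    ∃ f, G.LocalIso x x' r f := by
  classical
  let f : V → V := fun v => if h : v ∈ G.ballSet x r then (φ.iso ⟨v, h⟩ : V) else v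
  have hf : ∀ v (h : v ∈ G.ballSet x r), f v = φ.iso ⟨v, h⟩ := fun v h => dif_pos h
  refine ⟨f, ⟨fun v hv => ?_, fun u hu v hv h => ?_, fun v hv => ?_⟩, ?_, ?_, ?_, ?_⟩
  · rw [hf v hv]; exact (φ.iso ⟨v, hv⟩).2
  · rw [hf u hu, hf v hv] at h
    simpa using φ.iso.injective (Subtype.ext h)
  · refine ⟨φ.iso.symm ⟨v, hv⟩, (φ.iso.symm ⟨v, hv⟩).2, ?_⟩
    rw [hf _ (φ.iso.symm ⟨v, hv⟩).2]
    exact congrArg Subtype.val (φ.iso.apply_symm_apply ⟨v, hv⟩)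
  · rw [hf x (G.self_mem_ballSet x r)]
    exact congrArg Subtype.val φ.map_root
  · intro u hu v hv
    rw [hf u hu, hf v hv]
    exact φ.iso.map_adj_iff (v := ⟨u, hu⟩) (w := ⟨v, hv⟩)
  · intro u hu
    rw [hf u hu]
    exact φ.vertexColor_map ⟨u, hu⟩
  · intro u hu v hv h h'
    refine Eq.trans ?_ (φ.edgeColor_map ⟨u, hu⟩ ⟨v, hv⟩ h)
    exact edgeColor_congr G (hf u hu) (hf v hv) _ _

namespace LocalIso

variable {G : XSGraph V X S} {x x' : V} {r : ℕ} {f : V → V}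

theorem exists_rootedIso (hf : G.LocalIso x x' r f) :
    ∃ φ : RootedIso (G.ball x r) (G.ballRoot x r) (G.ball x' r) (G.ballRoot x' r),
      ∀ y, (φ.iso y : V) = f y :=
  ⟨{ iso := ⟨hf.bijOn.equiv f, fun {u v} => hf.adj_iff u u.2 v v.2⟩
     map_root := Subtype.ext hf.map_root
     vertexColor_map := fun v => hf.vertexColor_map v v.2
     edgeColor_map := fun u v h => hf.edgeColor_map u u.2 v v.2 h _ }, fun _ => rfl⟩

theorem exists_symm (hf : G.LocalIso x x' r f) :
    ∃ g, G.LocalIso x' x r g ∧ Set.InvOn g f (G.ballSet x r) (G.ballSet x' r) := by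
  have : Nonempty V := ⟨x⟩
  have hinv := hf.bijOn.invOn_invFunOn
  set g := Function.invFunOn f (G.ballSet x r) with hg
  have hbij : Set.BijOn g (G.ballSet x' r) (G.ballSet x r) := hf.bijOn.symm hinv.symm
  refine ⟨g, ⟨hbij, ?_, ?_, ?_, ?_⟩, hinv⟩
  · rw [← hf.map_root]; exact hinv.1 (G.self_mem_ballSet x r)
  · intro u hu v hv
    rw [← hf.adj_iff _ (hbij.mapsTo hu) _ (hbij.mapsTo hv), hinv.2 hu, hinv.2 hv]
  · intro u hu
    rw [← hf.vertexColor_map _ (hbij.mapsTo hu), hinv.2 hu]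
  · intro u hu v hv h h'
    have h'' : G.graph.Adj (f (g u)) (f (g v)) := by rwa [hinv.2 hu, hinv.2 hv]
    rw [← hf.edgeColor_map _ (hbij.mapsTo hu) _ (hbij.mapsTo hv) h' h'']
    exact edgeColor_congr G (hinv.2 hu) (hinv.2 hv) _ _

theorem map_mem_ballSet (hf : G.LocalIso x x' r f) {y z : V} {a t : ℕ} (hy : y ∈ G.ballSet x a)
    (hat : a + t ≤ r) (hz : z ∈ G.ballSet y t) : f z ∈ G.ballSet (f y) t := by
  induction t generalizing z with
  | zero =>
    have h0 : G.graph.edist y z = 0 := by simpa [mem_ballSet] using hz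
    rw [SimpleGraph.edist_eq_zero_iff.1 h0]
    exact self_mem_ballSet _ _ _
  | succ t ih =>
    rcases SimpleGraph.edist_le_succ_cases hz with h | ⟨w, hw, hwz⟩
    · exact ballSet_mono _ _ (Nat.le_succ t) (ih (by omega) h)
    · have h1 : w ∈ G.ballSet x r := SimpleGraph.edist_le_add hy hw (by omega)
      have h2 : z ∈ G.ballSet x r := SimpleGraph.edist_le_add hy hz hat
      have hadj := (hf.adj_iff w h1 z h2).2 hwz
      refine SimpleGraph.edist_le_add (ih (by omega) hw) (b := 1) ?_ le_rfl
      exact_mod_cast (SimpleGraph.edist_eq_one_iff_adj.2 hadj).le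

/-- A local isomorphism restricts to the smaller balls inside its domain, around any center. -/
theorem restrict (hf : G.LocalIso x x' r f) {y : V} {a t : ℕ} (hy : y ∈ G.ballSet x a)
    (hat : a + t ≤ r) : G.LocalIso y (f y) t f := by
  have hsub : G.ballSet y t ⊆ G.ballSet x r := fun z hz => SimpleGraph.edist_le_add hy hz hat
  have hyr : y ∈ G.ballSet x r := hsub (self_mem_ballSet _ _ _)
  have hfy : f y ∈ G.ballSet x' a := by
    have := hf.map_mem_ballSet (y := x) (a := 0) (t := a) (self_mem_ballSet _ _ _) (by omega) hy
    rwa [hf.map_root] at this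
  obtain ⟨g, hg, hinv⟩ := hf.exists_symm
  refine ⟨⟨fun z hz => hf.map_mem_ballSet hy hat hz, hf.bijOn.injOn.mono hsub, fun z hz => ?_⟩, rfl,
    fun u hu v hv => hf.adj_iff u (hsub hu) v (hsub hv), fun u hu => hf.vertexColor_map u (hsub hu),
    fun u hu v hv => hf.edgeColor_map u (hsub hu) v (hsub hv)⟩
  have hz' : z ∈ G.ballSet x' r := SimpleGraph.edist_le_add hfy hz hat
  refine ⟨g z, ?_, hinv.2 hz'⟩
  have := hg.map_mem_ballSet hfy hat hz
  rwa [hinv.1 hyr] at this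

theorem root (hf : G.LocalIso x x' r f) {t : ℕ} (ht : t ≤ r) : G.LocalIso x x' t f := by
  have := hf.restrict (a := 0) (t := t) (self_mem_ballSet _ _ _) (by omega)
  rwa [hf.map_root] at this

end LocalIso

end XSGraph

namespace XSGraph

variable {V V' X S : Type*}

/-! ### Finitely many patterns -/

/-- Transport of a colored graph along a bijection of the vertex sets. -/
def transport (G : XSGraph V X S) (e : V ≃ V') : XSGraph V' X S where
  graph := G.graph.comap e.symm
  vertexColor v := G.vertexColor (e.symm v)
  edgeColor u v h := G.edgeColor (e.symm u) (e.symm v) h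

/-- A graph is isomorphic to its transport. -/
def rootedIsoTransport (G : XSGraph V X S) (e : V ≃ V') (x : V) :
    RootedIso G x (G.transport e) (e x) where
  iso := ⟨e, fun {u v} => by simp [transport]⟩
  map_root := rfl
  vertexColor_map v := congrArg G.vertexColor (e.symm_apply_apply v)
  edgeColor_map u v h := edgeColor_congr G (by simp) (by simp) _ _

/-- The balls of radius `r` have models on the vertex sets `Fin m` with bounded `m`; this makes the
number of patterns finite. -/
theorem DegreeBound.exists_fin_model {G : XSGraph V X S} {d : ℕ} (hG : G.DegreeBound d)
    (x : V) (r : ℕ) : ∃ (m : Fin ((d + 1) ^ r + 1)) (α : XSGraph (Fin m) X S) (o : Fin m),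
      Nonempty (RootedIso (G.ball x r) (G.ballRoot x r) α o) := by
  have hfin := hG.finite_ballSet x r
  have : Finite (G.ballSet x r) := hfin
  have hcard : Nat.card (G.ballSet x r) = (G.ballSet x r).ncard := rfl
  let e := Finite.equivFinOfCardEq hcard
  exact ⟨⟨_, Nat.lt_succ_of_le (hG.ncard_ballSet_le x r)⟩, (G.ball x r).transport e,
    e (G.ballRoot x r), ⟨(G.ball x r).rootedIsoTransport e (G.ballRoot x r)⟩⟩

instance [Finite V] [Finite X] [Finite S] : Finite (XSGraph V X S) := by
  let F : XSGraph V X S →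
      Σ g : SimpleGraph V, (V → X) × (∀ x y : V, g.Adj x y → S) :=
    fun G => ⟨G.graph, G.vertexColor, G.edgeColor⟩
  refine Finite.of_injective F ?_
  rintro ⟨g, c, e⟩ ⟨g', c', e'⟩ h
  simp only [F, Sigma.mk.injEq] at h
  obtain ⟨rfl, h⟩ := h
  simp only [heq_eq_eq, Prod.mk.injEq] at h
  obtain ⟨rfl, rfl⟩ := h
  rfl

/-- Two vertices are equivalent if their `r`-balls are isomorphic as rooted colored graphs. -/
def ballSetoid (G : XSGraph V X S) (r : ℕ) : Setoid V where
  r x x' := Nonempty (RootedIso (G.ball x r) (G.ballRoot x r) (G.ball x' r) (G.ballRoot x' r))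
  iseqv := ⟨fun _ => ⟨⟨SimpleGraph.Iso.refl, rfl, fun _ => rfl, fun _ _ _ => rfl⟩⟩,
    fun ⟨φ⟩ => ⟨φ.symm⟩, fun ⟨φ⟩ ⟨ψ⟩ => ⟨φ.trans ψ⟩⟩

theorem DegreeBound.finite_quotient_ballSetoid [Finite X] [Finite S] {G : XSGraph V X S} {d : ℕ}
    (hG : G.DegreeBound d) (r : ℕ) : Finite (Quotient (G.ballSetoid r)) := by
  choose m α o h using fun x => hG.exists_fin_model x r
  let F : Quotient (G.ballSetoid r) →
      Σ m : Fin ((d + 1) ^ r + 1), XSGraph (Fin m) X S × Fin m :=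
    fun q => ⟨m q.out, α q.out, o q.out⟩
  refine Finite.of_injective F fun p q hpq => ?_
  rw [← p.out_eq, ← q.out_eq]
  refine Quotient.sound ?_
  obtain ⟨φ⟩ := h p.out
  have key : ∀ t : Σ m : Fin ((d + 1) ^ r + 1), XSGraph (Fin m) X S × Fin m, F q = t →
      Nonempty (RootedIso (G.ball q.out r) (G.ballRoot q.out r) t.2.1 t.2.2) := by
    rintro _ rfl
    exact h q.out
  obtain ⟨ψ⟩ := key (F p) hpq.symm
  exact ⟨φ.trans ψ.symm⟩

/-! ### Pattern frequencies and averages of local functions -/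

/-- Shortest paths from the center of a ball stay in the ball. -/
theorem exists_walk_ball {G : XSGraph V X S} {x y : V} {r : ℕ} (hy : y ∈ G.ballSet x r) :
    ∃ p : (G.ball x r).graph.Walk (G.ballRoot x r) ⟨y, hy⟩, p.length ≤ r := by
  obtain ⟨p, hp⟩ := SimpleGraph.exists_walk_length_le_of_edist_le hy
  have hball : ∀ z ∈ p.support, z ∈ G.ballSet x r := fun z hz =>
    (SimpleGraph.edist_le_of_mem_support p hz).trans (by exact_mod_cast hp)
  exact ⟨p.induce _ hball, (p.length_induce hball).trans_le hp⟩

theorem DegreeBound.isRootedPattern {G : XSGraph V X S} {d : ℕ} (hG : G.DegreeBound d)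
    {x : V} {r m : ℕ} {α : XSGraph (Fin m) X S} {o : Fin m}
    (φ : RootedIso (G.ball x r) (G.ballRoot x r) α o) : IsRootedPattern d r α o where
  connected := by
    rw [← φ.iso.connected_iff]
    have : Nonempty (G.ballSet x r) := ⟨G.ballRoot x r⟩
    refine ⟨fun y z => ?_⟩
    obtain ⟨p, -⟩ := exists_walk_ball y.2
    obtain ⟨q, -⟩ := exists_walk_ball z.2
    exact p.reachable.symm.trans q.reachable
  degreeBound v := by
    refine le_trans ?_ (hG (φ.iso.symm v))
    have hinj : Function.Injective fun w => (φ.iso.symm w : V) :=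
      Subtype.val_injective.comp φ.iso.symm.injective
    rw [← hinj.encard_image]
    refine Set.encard_le_encard ?_
    rintro _ ⟨w, hw, rfl⟩
    exact φ.iso.symm.map_adj_iff.2 hw
  radius z := by
    obtain ⟨p, hp⟩ := exists_walk_ball (φ.iso.symm z).2
    have h := SimpleGraph.edist_le (p.map φ.iso.toHom)
    rw [SimpleGraph.Walk.length_map] at h
    have h1 : φ.iso.toHom (G.ballRoot x r) = o := φ.map_root
    have h2 : φ.iso.toHom (φ.iso.symm z) = z := φ.iso.apply_symm_apply z
    rw [h1] at h
    erw [h2] at h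
    exact h.trans (by exact_mod_cast hp)

/-- Away from the boundary of `W`, the balls of the spanned subgraph are those of `G`. -/
theorem nonempty_rootedIso_ball_induce {G : XSGraph V X S} {W : Set V} (x : W) {r : ℕ}
    (hB : ∀ z ∈ G.ballSet (x : V) r, z ∉ G.boundary W) :
    Nonempty (RootedIso ((G.induce W).ball x r) ((G.induce W).ballRoot x r)
      (G.ball (x : V) r) (G.ballRoot (x : V) r)) := by
  have hmem : ∀ y : W, y ∈ (G.induce W).ballSet x r → (y : V) ∈ G.ballSet (x : V) r := by
    intro y hy
    obtain ⟨p, hp⟩ := SimpleGraph.exists_walk_length_le_of_edist_le hy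
    let ι : (G.induce W).graph →g G.graph := ⟨Subtype.val, fun h => h⟩
    refine (SimpleGraph.edist_le (p.map ι)).trans ?_
    rw [SimpleGraph.Walk.length_map]
    exact_mod_cast hp
  let f : (G.induce W).ballSet x r → G.ballSet (x : V) r := fun y => ⟨y.1.1, hmem _ y.2⟩
  have hf : Function.Bijective f := by
    refine ⟨fun y z h => ?_, fun y => ?_⟩
    · exact Subtype.ext (Subtype.ext (congrArg (Subtype.val : G.ballSet (x : V) r → V) h))
    · obtain ⟨hyW, p, hp, -⟩ := exists_walk_induce x.2 hB y.2
      refine ⟨⟨⟨y, hyW⟩, ?_⟩, rfl⟩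
      exact (SimpleGraph.edist_le p).trans (by exact_mod_cast hp)
  exact ⟨{ iso := ⟨Equiv.ofBijective f hf, Iff.rfl⟩
           map_root := rfl
           vertexColor_map := fun _ => rfl
           edgeColor_map := fun _ _ _ => rfl }⟩

theorem abs_ncard_sub_ncard_le {ι : Type*} [Finite ι] {P Q B : Set ι}
    (h : ∀ x, x ∉ B → (x ∈ P ↔ x ∈ Q)) : |(P.ncard : ℝ) - Q.ncard| ≤ B.ncard := by
  have key : ∀ P Q : Set ι, (∀ x, x ∉ B → (x ∈ P ↔ x ∈ Q)) →
      (P.ncard : ℝ) ≤ Q.ncard + B.ncard := by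
    intro P Q h
    have : P ⊆ Q ∪ B := fun x hx => by
      by_cases hB : x ∈ B
      · exact Or.inr hB
      · exact Or.inl ((h x hB).1 hx)
    exact_mod_cast (Set.ncard_le_ncard this (Set.toFinite _)).trans (Set.ncard_union_le _ _)
  rw [abs_le]
  constructor
  · linarith [key Q P fun x hx => (h x hx).symm]
  · linarith [key P Q h]

theorem boundary_subset (G : XSGraph V X S) (W : Set V) : G.boundary W ⊆ W := fun _ h => h.1

/-- The vertices of `W` within distance `r` of `B`, as a set of vertices of the subgraph spanned
by `W`. -/
def near (G : XSGraph V X S) (W : Set V) (r : ℕ) (B : Set V) : Set W :=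
  {x | ∃ z ∈ G.ballSet (x : V) r, z ∈ B}

theorem DegreeBound.ncard_near_le {G : XSGraph V X S} {d : ℕ} (hG : G.DegreeBound d)
    (W : Set V) (r : ℕ) {B : Set V} (hB : B.Finite) :
    (G.near W r B).ncard ≤ B.ncard * (d + 1) ^ r := by
  obtain ⟨h1, h2⟩ := hG.ncard_thickening_le hB r
  refine le_trans ?_ h2
  rw [← Set.ncard_image_of_injective _ Subtype.val_injective]
  refine Set.ncard_le_ncard ?_ h1
  rintro _ ⟨x, hx, rfl⟩
  exact hx

theorem IsFolnerSequence.card_pos {G : XSGraph V X S} {W : ℕ → Finset V}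
    (hW : G.IsFolnerSequence W) (n : ℕ) : 0 < (W n).card := by
  obtain ⟨x⟩ := (hW.connected n).nonempty
  exact Finset.card_pos.2 ⟨x, x.2⟩

theorem IsFolnerSequence.tendsto_near {G : XSGraph V X S} {W : ℕ → Finset V} {d : ℕ}
    (hW : G.IsFolnerSequence W) (hG : G.DegreeBound d) (r : ℕ) :
    Tendsto (fun n => ((G.near (W n) r (G.boundary (W n))).ncard : ℝ) / (W n).card)
      atTop (𝓝 0) := by
  have h := hW.tendsto_boundary.mul_const (((d + 1) ^ r : ℕ) : ℝ)
  rw [zero_mul] at h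
  refine squeeze_zero (fun n => by positivity) (fun n => ?_) h
  rw [div_mul_eq_mul_div]
  gcongr
  exact_mod_cast hG.ncard_near_le _ r ((W n).finite_toSet.subset (G.boundary_subset _))

/-- Along a weakly convergent Følner sequence the average of a function converges if its value at
`x` depends only on the isomorphism class of the `r`-ball of `x`. -/
theorem IsFolnerSequence.tendsto_average [Finite X] [Finite S] {G : XSGraph V X S}
    {W : ℕ → Finset V} {d : ℕ} (hW : G.IsFolnerSequence W) (hG : G.DegreeBound d)
    (hconv : WeaklyConvergent d (G.inducedSequence W)) {r : ℕ} (hr : 1 ≤ r) {f : V → ℝ}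
    (hf : ∀ x x' g, G.LocalIso x x' r g → f x = f x') :
    ∃ L, Tendsto (fun n => (∑ x ∈ W n, f x) / (W n).card) atTop (𝓝 L) := by
  classical
  have := hG.finite_quotient_ballSetoid r
  have := Fintype.ofFinite (Quotient (G.ballSetoid r))
  have hfq : ∀ x, f x = f (Quotient.mk (G.ballSetoid r) x).out := by
    intro x
    obtain ⟨φ⟩ := Quotient.exact (Quotient.out_eq (Quotient.mk (G.ballSetoid r) x)).symm
    obtain ⟨g, hg⟩ := φ.exists_localIso
    exact hf _ _ g hg
  have hsum : ∀ n, (∑ x ∈ W n, f x) / (W n).card = ∑ q : Quotient (G.ballSetoid r),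
      (((W n).filter fun x => Quotient.mk (G.ballSetoid r) x = q).card : ℝ) / (W n).card
        * f q.out := by
    intro n
    rw [← Finset.sum_fiberwise (W n) (Quotient.mk (G.ballSetoid r)) f, Finset.sum_div]
    refine Finset.sum_congr rfl fun q _ => ?_
    rw [Finset.sum_congr rfl (g := fun _ => f q.out), Finset.sum_const, nsmul_eq_mul]
    · ring
    · intro x hx
      rw [hfq x, (Finset.mem_filter.1 hx).2]
  have hfreq : ∀ q : Quotient (G.ballSetoid r), ∃ p : ℝ, Tendsto (fun n =>
      (((W n).filter fun x => Quotient.mk (G.ballSetoid r) x = q).card : ℝ) / (W n).card)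
        atTop (𝓝 p) := by
    intro q
    obtain ⟨m, α, o, ⟨φ⟩⟩ := hG.exists_fin_model q.out r
    obtain ⟨p, hp⟩ := hconv.2 r hr m α o (hG.isRootedPattern φ)
    refine ⟨p, ?_⟩
    -- Patterns in `G` and in the spanned subgraph differ only near the boundary.
    have hdiff : Tendsto (fun n =>
        (((W n).filter fun x => Quotient.mk (G.ballSetoid r) x = q).card : ℝ) / (W n).card
          - (G.inducedSequence W n).patternFrequency r α o) atTop (𝓝 0) := by
      refine squeeze_zero_norm (fun n => ?_) (hW.tendsto_near hG r)
      have hcard : (Fintype.card ((W n : Set V)) : ℝ) = (W n).card := by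
        simp
      have h1 : ((W n).filter fun x => Quotient.mk (G.ballSetoid r) x = q).card
          = {x : (W n : Set V) | Quotient.mk (G.ballSetoid r) (x : V) = q}.ncard := by
        rw [← Set.ncard_image_of_injective _ Subtype.val_injective, ← Set.ncard_coe_finset]
        congr 1
        ext x
        simp [and_comm]
      rw [patternFrequency, hcard, ← sub_div, Real.norm_eq_abs, abs_div, Nat.abs_cast, h1]
      refine div_le_div_of_nonneg_right ?_ (Nat.cast_nonneg _)
      refine abs_ncard_sub_ncard_le fun x hx => ?_
      obtain ⟨ψ⟩ := nonempty_rootedIso_ball_induce (G := G) (W := (W n : Set V)) x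
        fun z hz hzB => hx ⟨z, hz, hzB⟩
      constructor
      · intro h
        rw [Set.mem_ofPred_eq, ← Quotient.out_eq q] at h
        obtain ⟨χ⟩ := Quotient.exact h
        exact ⟨(ψ.trans χ).trans φ⟩
      · rintro ⟨χ⟩
        rw [Set.mem_ofPred_eq, ← Quotient.out_eq q]
        exact Quotient.sound ⟨(ψ.symm.trans χ).trans φ.symm⟩
    simpa using hp.add hdiff
  choose p hp using hfreq
  refine ⟨∑ q, p q * f q.out, ?_⟩
  simp_rw [hsum]
  exact tendsto_finsetSum _ fun q _ => (hp q).mul_const _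

/-! ### Local kernels and their powers -/

/-- A kernel of range at most `s` whose row at `x` depends only on the pattern of the
`s`-ball of `x`. -/
structure IsLocalKernel (G : XSGraph V X S) (s : ℕ) (A : Matrix V V ℝ) : Prop where
  eq_zero : ∀ x y, y ∉ G.ballSet x s → A x y = 0
  map_eq : ∀ x x' f, G.LocalIso x x' s f → ∀ y ∈ G.ballSet x s, A x y = A x' (f y)

theorem IsPatternInvariant.exists_isLocalKernel {G : XSGraph V X S} {A : Matrix V V ℝ}
    (h : G.IsPatternInvariant A) : ∃ s, G.IsLocalKernel s A := by
  obtain ⟨s, h0, hinv⟩ := h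
  refine ⟨s, fun x y hy => h0 x y (not_le.1 hy), fun x x' f hf y hy => ?_⟩
  obtain ⟨φ, hφ⟩ := hf.exists_rootedIso
  rw [hinv x x' φ ⟨y, hy⟩, hφ]

theorem IsLocalKernel.finite_entries [Finite X] [Finite S] {G : XSGraph V X S} {d s : ℕ}
    {A : Matrix V V ℝ} (hA : G.IsLocalKernel s A) (hG : G.DegreeBound d) :
    ∃ E : Finset ℝ, ∀ x y, A x y ∈ E := by
  classical
  have := hG.finite_quotient_ballSetoid s
  have hfin : (insert 0 (⋃ q : Quotient (G.ballSetoid s),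
      A q.out '' G.ballSet q.out s) : Set ℝ).Finite :=
    (Set.finite_iUnion fun q => (hG.finite_ballSet _ s).image _).insert 0
  refine ⟨hfin.toFinset, fun x y => ?_⟩
  rw [Set.Finite.mem_toFinset]
  by_cases hy : y ∈ G.ballSet x s
  · refine Or.inr (Set.mem_iUnion.2 ⟨Quotient.mk (G.ballSetoid s) x, ?_⟩)
    obtain ⟨φ⟩ := Quotient.exact (Quotient.out_eq (Quotient.mk (G.ballSetoid s) x)).symm
    obtain ⟨f, hf⟩ := φ.exists_localIso
    exact ⟨f y, hf.bijOn.mapsTo hy, (hA.map_eq _ _ f hf y hy).symm⟩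
  · exact Or.inl (hA.eq_zero x y hy)

/-- The powers of a kernel. The sum has finitely many nonzero terms for the kernels of finite
range on a graph of bounded degree. -/
noncomputable def kernelPow (A : Matrix V V ℝ) : ℕ → Matrix V V ℝ
  | 0 => fun x z => Set.indicator {x} 1 z
  | k + 1 => fun x z => ∑ᶠ y, A x y * kernelPow A k y z

/-- The product of local kernels is local, and the ranges add up. -/
theorem IsLocalKernel.mul {G : XSGraph V X S} {d s t : ℕ} {A B : Matrix V V ℝ}
    (hG : G.DegreeBound d) (hA : G.IsLocalKernel s A) (hB : G.IsLocalKernel t B) :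
    G.IsLocalKernel (t + s) fun x z => ∑ᶠ y, A x y * B y z := by
  have hsum : ∀ x z, ∑ᶠ y, A x y * B y z =
      ∑ y ∈ (hG.finite_ballSet x s).toFinset, A x y * B y z := fun x z => by
    refine finsum_eq_sum_of_support_subset _ fun y hy => ?_
    rw [Finset.mem_coe, Set.Finite.mem_toFinset]
    by_contra h
    exact hy (by simp [hA.eq_zero x y h])
  refine ⟨fun x z hz => ?_, fun x x' f hf z hz => ?_⟩
  · rw [hsum]
    refine Finset.sum_eq_zero fun y hy => ?_
    rw [Set.Finite.mem_toFinset] at hy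
    rw [hB.eq_zero y z, mul_zero]
    exact fun h => hz (SimpleGraph.edist_le_add hy h (by omega))
  · rw [hsum, hsum]
    have hs := hf.root (t := s) (by omega)
    refine Finset.sum_bij (fun y _ => f y) ?_ ?_ ?_ ?_
    · intro y hy
      rw [Set.Finite.mem_toFinset] at hy ⊢
      exact hs.bijOn.mapsTo hy
    · intro y hy y' hy' h
      rw [Set.Finite.mem_toFinset] at hy hy'
      exact hs.bijOn.injOn hy hy' h
    · intro y hy
      rw [Set.Finite.mem_toFinset] at hy
      obtain ⟨y', hy', rfl⟩ := hs.bijOn.surjOn hy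
      exact ⟨y', by rwa [Set.Finite.mem_toFinset], rfl⟩
    · intro y hy
      rw [Set.Finite.mem_toFinset] at hy
      rw [hA.map_eq x x' f hs y hy]
      congr 1
      have hy' := hf.restrict hy (t := t) (by omega)
      by_cases hzt : z ∈ G.ballSet y t
      · exact hB.map_eq _ _ f hy' z hzt
      · rw [hB.eq_zero y z hzt, hB.eq_zero]
        intro h
        obtain ⟨z', hz', hzz'⟩ := hy'.bijOn.surjOn h
        have hz'' : z' ∈ G.ballSet x (t + s) := SimpleGraph.edist_le_add hy hz' (by omega)
        exact hzt (hf.bijOn.injOn hz'' hz hzz' ▸ hz')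

theorem IsLocalKernel.kernelPow {G : XSGraph V X S} {d s : ℕ} {A : Matrix V V ℝ}
    (hG : G.DegreeBound d) (hA : G.IsLocalKernel s A) (k : ℕ) :
    G.IsLocalKernel (k * s) (kernelPow A k) := by
  induction k with
  | zero =>
    rw [zero_mul]
    refine ⟨fun x y hy => ?_, fun x x' f hf y hy => ?_⟩
    · refine Set.indicator_of_notMem ?_ _
      rintro rfl
      exact hy (self_mem_ballSet _ _ _)
    · have h0 : G.graph.edist x y = 0 := by simpa [mem_ballSet] using hy
      obtain rfl := SimpleGraph.edist_eq_zero_iff.1 h0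
      simp [XSGraph.kernelPow, hf.map_root]
  | succ k ih =>
    rw [Nat.succ_mul]
    exact IsLocalKernel.mul hG hA ih

/-- At the points far from the boundary the powers of the finite volume approximation agree with
those of the kernel itself. -/
theorem IsLocalKernel.finiteVolume_pow_apply {G : XSGraph V X S} {s : ℕ}
    {A : Matrix V V ℝ} (hA : G.IsLocalKernel s A) (W : Finset V)
    [DecidableEq (W : Set V)] (k : ℕ) (x y : (W : Set V)) (hx : G.ballSet (x : V) (k * s) ⊆ W) :
    (finiteVolume A W ^ k) x y = XSGraph.kernelPow A k x y := by
  induction k generalizing x with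
  | zero =>
    by_cases h : x = y
    · subst h
      simp [XSGraph.kernelPow]
    · have h' : (y : V) ∉ ({(x : V)} : Set V) := fun h' => h (Subtype.ext h'.symm)
      rw [pow_zero, Matrix.one_apply_ne h]
      exact (Set.indicator_of_notMem h' _).symm
  | succ k ih =>
    have hball : ∀ z : V, z ∈ G.ballSet (x : V) s →
        z ∈ W ∧ G.ballSet z (k * s) ⊆ W := fun z hz =>
      ⟨hx (ballSet_mono G _ (by nlinarith) hz), fun w hw =>
        hx (SimpleGraph.edist_le_add hz hw (by rw [Nat.succ_mul, add_comm]))⟩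
    have hsupp : (Function.support fun z => A x z * XSGraph.kernelPow A k z y) ⊆ W := by
      intro z hz
      by_contra h
      exact hz (by simp [hA.eq_zero x z fun h' => h (hball z h').1])
    change _ = ∑ᶠ z, A x z * XSGraph.kernelPow A k z y
    rw [pow_succ', Matrix.mul_apply, finsum_eq_sum_of_support_subset _ hsupp,
      Finset.sum_subtype W (p := (· ∈ (W : Set V))) (fun _ => Iff.rfl)]
    refine Finset.sum_congr rfl fun z _ => ?_
    by_cases hz : (z : V) ∈ G.ballSet (x : V) s
    · rw [ih z (hball z hz).2]; rfl
    · have : A x z = 0 := hA.eq_zero _ _ hz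
      simp [finiteVolume, this]

end XSGraph

/-! ### Eigenvalues of symmetric matrices -/

namespace Matrix

namespace IsHermitian

variable {ι : Type*} [Fintype ι] [DecidableEq ι] {M N : Matrix ι ι ℝ}

theorem sum_eigenvalues_pow (hM : M.IsHermitian) (k : ℕ) :
    ∑ i, hM.eigenvalues i ^ k = (M ^ k).trace := by
  conv_rhs => rw [hM.spectral_theorem, ← map_pow, Unitary.conjStarAlgAut_apply,
    Matrix.trace_mul_comm, ← mul_assoc]
  simp [Matrix.diagonal_pow, Matrix.trace_diagonal]

theorem abs_eigenvalues_le (hM : M.IsHermitian) {C : ℝ} (hC : ∀ x, ∑ y, |M x y| ≤ C) (i : ι) :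
    |hM.eigenvalues i| ≤ C := by
  have hev : Module.End.HasEigenvalue (Matrix.toLin' M) (hM.eigenvalues i) := by
    rw [Module.End.hasEigenvalue_iff_mem_spectrum, Matrix.spectrum_toLin']
    exact hM.eigenvalues_mem_spectrum_real i
  obtain ⟨x, hx⟩ := eigenvalue_mem_ball hev
  rw [Metric.mem_closedBall, Real.dist_eq] at hx
  refine le_trans ?_ (hC x)
  rw [← Finset.add_sum_erase _ _ (Finset.mem_univ x)]
  simp only [Real.norm_eq_abs] at hx
  have h := abs_sub_abs_le_abs_sub (hM.eigenvalues i) (M x x)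
  linarith

theorem dotProduct_mulVec_eq_sum (hM : M.IsHermitian) (v : EuclideanSpace ℝ ι) :
    v.ofLp ⬝ᵥ M *ᵥ v.ofLp =
      ∑ i, hM.eigenvalues i * (hM.eigenvectorBasis.repr v i) ^ 2 := by
  have h := hM.eigenvectorBasis.sum_inner_mul_inner v (WithLp.toLp 2 (M *ᵥ v.ofLp))
  have h1 : inner ℝ v (WithLp.toLp 2 (M *ᵥ v.ofLp)) = v.ofLp ⬝ᵥ M *ᵥ v.ofLp := by
    rw [EuclideanSpace.inner_eq_star_dotProduct, dotProduct_comm]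
    simp
  rw [← h1, ← h]
  refine Finset.sum_congr rfl fun i _ => ?_
  have h2 : inner ℝ (hM.eigenvectorBasis i) (WithLp.toLp 2 (M *ᵥ v.ofLp)) =
      hM.eigenvalues i * hM.eigenvectorBasis.repr v i := by
    rw [OrthonormalBasis.repr_apply_apply, EuclideanSpace.inner_eq_star_dotProduct,
      EuclideanSpace.inner_eq_star_dotProduct]
    simp only [star_trivial]
    have hT : Mᵀ = M := by rw [← conjTranspose_eq_transpose_of_trivial, hM.eq]
    rw [dotProduct_comm, dotProduct_mulVec, ← mulVec_transpose, hT, hM.mulVec_eigenvectorBasis,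
      smul_dotProduct, dotProduct_comm, smul_eq_mul]
  rw [h2, OrthonormalBasis.repr_apply_apply, real_inner_comm]
  ring

/-- If the quadratic forms of two symmetric matrices agree on the vectors that vanish on `B`, the
eigenvalue counting functions differ by at most `|B|`. -/
theorem card_eigenvalues_le_le (hM : M.IsHermitian) (hN : N.IsHermitian) (B : Set ι)
    (h : ∀ v : ι → ℝ, (∀ x ∈ B, v x = 0) → v ⬝ᵥ M *ᵥ v = v ⬝ᵥ N *ᵥ v) (t : ℝ) :
    (Finset.univ.filter fun i => hM.eigenvalues i ≤ t).card ≤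
      (Finset.univ.filter fun i => hN.eigenvalues i ≤ t).card + B.ncard := by
  classical
  by_contra! hlt
  -- A nonzero vector that vanishes on `B`, lies in the span of the eigenvectors of `M` for the
  -- eigenvalues `≤ t`, and is orthogonal to those of `N`.
  let Φ : EuclideanSpace ℝ ι →ₗ[ℝ] ({i // ¬ hM.eigenvalues i ≤ t} → ℝ) ×
      ({i // hN.eigenvalues i ≤ t} → ℝ) × (B → ℝ) :=
    { toFun := fun v => (fun i => hM.eigenvectorBasis.repr v i,
        fun i => hN.eigenvectorBasis.repr v i, fun x => v x)
      map_add' := fun v w => by ext <;> simp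
      map_smul' := fun c v => by ext <;> simp }
  have hker : LinearMap.ker Φ ≠ ⊥ := by
    apply LinearMap.ker_ne_bot_of_finrank_lt
    have hB : Fintype.card B = B.ncard := (Set.ncard_eq_toFinset_card' B ▸ (Set.toFinset_card B)).symm
    rw [finrank_euclideanSpace, Module.finrank_prod, Module.finrank_prod,
      Module.finrank_fintype_fun_eq_card, Module.finrank_fintype_fun_eq_card,
      Module.finrank_fintype_fun_eq_card, hB, Fintype.card_subtype_compl, Fintype.card_subtype,
      Fintype.card_subtype]
    have := Finset.card_le_univ (Finset.univ.filter fun i => hM.eigenvalues i ≤ t)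
    omega
  obtain ⟨v, hv, hv0⟩ := Submodule.exists_mem_ne_zero_of_ne_bot hker
  rw [LinearMap.mem_ker] at hv
  have h1 : ∀ i, ¬ hM.eigenvalues i ≤ t → hM.eigenvectorBasis.repr v i = 0 := fun i hi =>
    congrFun (congrArg Prod.fst hv) ⟨i, hi⟩
  have h2 : ∀ i, hN.eigenvalues i ≤ t → hN.eigenvectorBasis.repr v i = 0 := fun i hi =>
    congrFun (congrArg (fun p => p.2.1) hv) ⟨i, hi⟩
  have h3 : ∀ x ∈ B, v x = 0 := fun x hx => congrFun (congrArg (fun p => p.2.2) hv) ⟨x, hx⟩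
  have hform := h v.ofLp h3
  rw [hM.dotProduct_mulVec_eq_sum v, hN.dotProduct_mulVec_eq_sum v] at hform
  have hnorm : ∀ b : OrthonormalBasis ι ℝ (EuclideanSpace ℝ ι),
      ∑ i, (b.repr v i) ^ 2 = ‖v‖ ^ 2 := fun b => by
    rw [← b.repr.norm_map v, EuclideanSpace.real_norm_sq_eq]
  have hle : ∑ i, hM.eigenvalues i * (hM.eigenvectorBasis.repr v i) ^ 2 ≤ t * ‖v‖ ^ 2 := by
    rw [← hnorm hM.eigenvectorBasis, Finset.mul_sum]
    refine Finset.sum_le_sum fun i _ => ?_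
    by_cases hi : hM.eigenvalues i ≤ t
    · gcongr
    · simp [h1 i hi]
  have hgt : t * ‖v‖ ^ 2 < ∑ i, hN.eigenvalues i * (hN.eigenvectorBasis.repr v i) ^ 2 := by
    rw [← hnorm hN.eigenvectorBasis, Finset.mul_sum]
    have hne : hN.eigenvectorBasis.repr v ≠ 0 := by simpa using hv0
    obtain ⟨j, hj⟩ : ∃ j, hN.eigenvectorBasis.repr v j ≠ 0 := by
      by_contra! hall
      exact hne (PiLp.ext hall)
    refine Finset.sum_lt_sum (fun i _ => ?_) ⟨j, Finset.mem_univ _, ?_⟩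
    · by_cases hi : hN.eigenvalues i ≤ t
      · simp [h2 i hi]
      · have := (not_le.1 hi).le
        gcongr
    · have hj' : t < hN.eigenvalues j := by
        by_contra! hle
        exact hj (h2 j hle)
      have : 0 < (hN.eigenvectorBasis.repr v j) ^ 2 := by positivity
      gcongr
  linarith

end IsHermitian

/-- Block diagonal symmetric matrices with entries in a finite set and with blocks of bounded size
have eigenvalues in a finite set. -/
theorem exists_finset_eigenvalues_mem (E : Finset ℝ) (K : ℕ) : ∃ Λ : Finset ℝ,
    ∀ {ι : Type*} [Fintype ι] [DecidableEq ι] {γ : Type*} (c : ι → γ) (M : Matrix ι ι ℝ)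
      (hM : M.IsHermitian), (∀ x y, M x y ∈ E) → (∀ x y, M x y ≠ 0 → c x = c y) →
      (∀ x, {y | c y = c x}.ncard ≤ K) → ∀ i, hM.eigenvalues i ∈ Λ := by
  classical
  have hfin : (⋃ m : Fin (K + 1), ⋃ N : Fin m → Fin m → E,
      spectrum ℝ (Matrix.of fun i j => (N i j : ℝ))).Finite :=
    Set.finite_iUnion fun m => Set.finite_iUnion fun N => Matrix.finite_real_spectrum
  refine ⟨hfin.toFinset, fun {ι} _ _ {γ} c M hM hE hblock hK i => ?_⟩
  rw [Set.Finite.mem_toFinset]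
  set v := (hM.eigenvectorBasis i).ofLp with hv
  have hMv : M *ᵥ v = hM.eigenvalues i • v := hM.mulVec_eigenvectorBasis i
  obtain ⟨x, hx⟩ : ∃ x, v x ≠ 0 := by
    by_contra! h
    exact hM.eigenvectorBasis.orthonormal.ne_zero i (PiLp.ext h)
  let s : Set ι := {y | c y = c x}
  have hcard : Nat.card s = s.ncard := rfl
  let e : s ≃ Fin s.ncard := Finite.equivFinOfCardEq hcard
  let N : Fin s.ncard → Fin s.ncard → E := fun j k => ⟨M (e.symm j) (e.symm k), hE _ _⟩
  refine Set.mem_iUnion.2 ⟨⟨s.ncard, Nat.lt_succ_of_le (hK x)⟩, Set.mem_iUnion.2 ⟨N, ?_⟩⟩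
  rw [← Matrix.spectrum_toLin', ← Module.End.hasEigenvalue_iff_mem_spectrum]
  let w : Fin s.ncard → ℝ := fun j => v (e.symm j)
  have hw : w ≠ 0 := fun h => hx <|
    (congrArg (fun y : s => v y) (e.symm_apply_apply ⟨x, rfl⟩)).symm.trans (congrFun h (e ⟨x, rfl⟩))
  refine Module.End.hasEigenvalue_of_hasEigenvector (x := w) ⟨?_, hw⟩
  rw [Module.End.mem_eigenspace_iff, Matrix.toLin'_apply]
  funext j
  have hj := congrFun hMv (e.symm j)
  refine Eq.trans ?_ hj
  simp only [Matrix.mulVec, dotProduct, Matrix.of_apply, N, w]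
  rw [Equiv.sum_comp e.symm fun y : s => M (e.symm j) y * v y,
    Finset.sum_set_coe s (f := fun y => M (e.symm j) y * v y)]
  refine Finset.sum_subset (Finset.subset_univ _) fun y _ hy => ?_
  rw [Set.mem_toFinset] at hy
  rw [mul_eq_zero]
  left
  by_contra hne
  exact hy ((hblock _ _ hne).symm.trans (e.symm j).2)

end Matrix

/-! ### Uniform convergence of empirical distribution functions -/

/-- The distribution function of the uniform probability measure on a finite family of reals. -/
noncomputable def empiricalCDF {ι : Type*} [Fintype ι] (e : ι → ℝ) (t : ℝ) : ℝ :=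
  ({i | e i ≤ t}.ncard : ℝ) / Fintype.card ι

section EmpiricalCDF

variable {ι : Type*} [Fintype ι] (e : ι → ℝ)

theorem empiricalCDF_mono : Monotone (empiricalCDF e) := fun s t h => by
  unfold empiricalCDF
  refine div_le_div_of_nonneg_right ?_ (Nat.cast_nonneg _)
  exact_mod_cast Set.ncard_le_ncard (fun i (hi : e i ≤ s) => hi.trans h) (Set.toFinite _)

theorem empiricalCDF_continuousWithinAt (t : ℝ) :
    ContinuousWithinAt (empiricalCDF e) (Set.Ici t) t := by
  have hev : ∀ᶠ s in 𝓝[≥] t, ∀ i, (e i ≤ s ↔ e i ≤ t) := by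
    rw [eventually_all]
    intro i
    by_cases h : e i ≤ t
    · filter_upwards [self_mem_nhdsWithin] with s hs
      exact ⟨fun _ => h, fun _ => h.trans hs⟩
    · filter_upwards [mem_nhdsWithin_of_mem_nhds (Iio_mem_nhds (not_le.1 h))] with s hs
      exact ⟨fun h' => absurd hs (not_lt.2 h'), fun h' => absurd h' h⟩
  refine tendsto_const_nhds.congr' ?_
  filter_upwards [hev] with s hs
  unfold empiricalCDF
  simp_rw [hs]

theorem empiricalCDF_eq_average (t : ℝ) :
    empiricalCDF e t = (∑ i, Set.indicator (Set.Iic t) (1 : ℝ → ℝ) (e i)) / Fintype.card ι := by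
  classical
  unfold empiricalCDF
  congr 1
  simp_rw [Set.indicator_apply, Set.mem_Iic, Pi.one_apply, Finset.sum_boole]
  rw [← Set.ncard_coe_finset]
  congr 2
  ext i
  simp

theorem empiricalCDF_le_average {g : ℝ → ℝ} {t : ℝ} (h0 : ∀ x, 0 ≤ g x) (h1 : ∀ x ≤ t, 1 ≤ g x) :
    empiricalCDF e t ≤ (∑ i, g (e i)) / Fintype.card ι := by
  rw [empiricalCDF_eq_average]
  refine div_le_div_of_nonneg_right (Finset.sum_le_sum fun i _ => ?_) (Nat.cast_nonneg _)
  exact Set.indicator_le' (f := (1 : ℝ → ℝ)) (fun x hx => h1 x hx) (fun x _ => h0 x) (e i)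

theorem average_le_empiricalCDF {g : ℝ → ℝ} {t : ℝ} (h1 : ∀ x, g x ≤ 1) (h0 : ∀ x, t < x → g x ≤ 0) :
    (∑ i, g (e i)) / Fintype.card ι ≤ empiricalCDF e t := by
  rw [empiricalCDF_eq_average]
  refine div_le_div_of_nonneg_right (Finset.sum_le_sum fun i _ => ?_) (Nat.cast_nonneg _)
  exact Set.le_indicator (g := (1 : ℝ → ℝ)) (fun x _ => h1 x) (fun x hx => h0 x (not_le.1 hx)) (e i)

theorem empiricalCDF_eq_zero {t : ℝ} (h : ∀ i, t < e i) : empiricalCDF e t = 0 := by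
  have : {i | e i ≤ t} = ∅ := Set.eq_empty_of_forall_notMem fun i hi => (h i).not_ge hi
  simp [empiricalCDF, this]

theorem empiricalCDF_eq_one [Nonempty ι] {t : ℝ} (h : ∀ i, e i ≤ t) : empiricalCDF e t = 1 := by
  have : {i | e i ≤ t} = Set.univ := Set.eq_univ_of_forall h
  simp [empiricalCDF, this, Set.ncard_univ]

theorem empiricalCDF_congr {s t : ℝ} (h : ∀ i, e i ≤ s ↔ e i ≤ t) :
    empiricalCDF e s = empiricalCDF e t := by
  unfold empiricalCDF
  simp_rw [h]

end EmpiricalCDF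

section Sequence

variable {ι : ℕ → Type*} [∀ n, Fintype (ι n)]

/-- Convergence of the moments of uniformly bounded families implies convergence of the averages
of every continuous function, by the theorem of Weierstrass. -/
theorem exists_tendsto_average_of_moments [∀ n, Nonempty (ι n)] {e : ∀ n, ι n → ℝ} {C : ℝ}
    (hC : ∀ n i, |e n i| ≤ C)
    (hmom : ∀ k : ℕ, ∃ L, Tendsto (fun n => (∑ i, e n i ^ k) / Fintype.card (ι n)) atTop (𝓝 L))
    {g : ℝ → ℝ} (hg : Continuous g) :
    ∃ L, Tendsto (fun n => (∑ i, g (e n i)) / Fintype.card (ι n)) atTop (𝓝 L) := by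
  refine cauchySeq_tendsto_of_complete ?_
  rw [Metric.cauchySeq_iff]
  intro ε hε
  obtain ⟨p, hp⟩ := exists_polynomial_near_of_continuousOn (-C) C g hg.continuousOn (ε / 4)
    (by positivity)
  have hpoly : ∃ L, Tendsto (fun n => (∑ i, p.eval (e n i)) / Fintype.card (ι n)) atTop (𝓝 L) := by
    choose L hL using hmom
    refine ⟨∑ k ∈ Finset.range (p.natDegree + 1), p.coeff k * L k, ?_⟩
    have : ∀ n, (∑ i, p.eval (e n i)) / Fintype.card (ι n) =
        ∑ k ∈ Finset.range (p.natDegree + 1),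
          p.coeff k * ((∑ i, e n i ^ k) / Fintype.card (ι n)) := fun n => by
      simp_rw [Polynomial.eval_eq_sum_range]
      rw [Finset.sum_comm, Finset.sum_div]
      simp_rw [← Finset.mul_sum, mul_div_assoc]
    simp_rw [this]
    exact tendsto_finsetSum _ fun k _ => (hL k).const_mul _
  obtain ⟨L, hL⟩ := hpoly
  have hnear : ∀ n, |(∑ i, p.eval (e n i)) / Fintype.card (ι n) -
      (∑ i, g (e n i)) / Fintype.card (ι n)| ≤ ε / 4 := fun n => by
    have hpos : (0 : ℝ) < Fintype.card (ι n) := by exact_mod_cast Fintype.card_pos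
    rw [← sub_div, ← Finset.sum_sub_distrib, abs_div, Nat.abs_cast, div_le_iff₀ hpos]
    refine (Finset.abs_sum_le_sum_abs _ _).trans ?_
    refine (Finset.sum_le_card_nsmul _ _ (ε / 4) fun i _ => ?_).trans ?_
    · exact (hp _ (abs_le.1 (hC n i))).le
    · rw [nsmul_eq_mul, mul_comm, Finset.card_univ]
  obtain ⟨n₀, hn₀⟩ := Metric.cauchySeq_iff.1 hL.cauchySeq (ε / 4) (by positivity)
  refine ⟨n₀, fun m hm n hn => ?_⟩
  have h := hn₀ m hm n hn
  rw [Real.dist_eq] at h ⊢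
  have h1 := abs_le.1 (hnear m)
  have h2 := abs_le.1 (hnear n)
  have h3 := abs_lt.1 h
  rw [abs_lt]
  constructor <;> linarith [h1.1, h1.2, h2.1, h2.2, h3.1, h3.2]

/-- If the moments converge and the distribution functions are, up to any uniform error, eventually
constant on the gaps of a finite set, then they converge uniformly. -/
theorem exists_tendstoUniformly_empiricalCDF [∀ n, Nonempty (ι n)] {e : ∀ n, ι n → ℝ} {C : ℝ}
    (hC : ∀ n i, |e n i| ≤ C)
    (hmom : ∀ k : ℕ, ∃ L, Tendsto (fun n => (∑ i, e n i ^ k) / Fintype.card (ι n)) atTop (𝓝 L))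
    (hgap : ∀ ε : ℝ, 0 < ε → ∃ Λ : Finset ℝ, ∀ᶠ n in atTop, ∀ s t : ℝ,
      (∀ l ∈ Λ, l ≤ s ↔ l ≤ t) → |empiricalCDF (e n) s - empiricalCDF (e n) t| ≤ ε) :
    ∃ σ : ℝ → ℝ, Monotone σ ∧ (∀ t, ContinuousWithinAt σ (Set.Ici t) t) ∧
      TendstoUniformly (fun n => empiricalCDF (e n)) σ atTop := by
  classical
  -- In the gap `[a, b)` of the finite set the distribution function is compared with the average
  -- of a continuous function that decreases from `1` at `a` to `0` at the midpoint of the gap.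
  let g : ℝ × ℝ → ℝ → ℝ := fun q x => max 0 (min 1 (((q.1 + q.2) / 2 - x) / ((q.2 - q.1) / 2)))
  have hg : ∀ q, Continuous (g q) := fun q => by fun_prop
  have hcauchy : UniformCauchySeqOn (fun n => empiricalCDF (e n)) atTop Set.univ := by
    rw [Metric.uniformCauchySeqOn_iff]
    intro ε hε
    obtain ⟨Λ, hΛ⟩ := hgap (ε / 8) (by positivity)
    -- Adding the two end points makes every relevant `t` lie in a bounded gap.
    let Λ' : Finset ℝ := insert (-C - 1) (insert (C + 1) Λ)
    have hcau : ∀ q : ℝ × ℝ, ∀ᶠ n₀ in atTop, ∀ m ≥ n₀, ∀ n ≥ n₀,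
        |(∑ i, g q (e m i)) / Fintype.card (ι m) - (∑ i, g q (e n i)) / Fintype.card (ι n)|
          < ε / 8 := by
      intro q
      obtain ⟨L, hL⟩ := exists_tendsto_average_of_moments hC hmom (hg q)
      obtain ⟨n₀, hn₀⟩ := Metric.cauchySeq_iff.1 hL.cauchySeq (ε / 8) (by positivity)
      filter_upwards [eventually_ge_atTop n₀] with n₁ hn₁ m hm n hn
      exact hn₀ m (hn₁.trans hm) n (hn₁.trans hn)
    have hall : ∀ᶠ n₀ in atTop, ∀ q ∈ Λ' ×ˢ Λ', ∀ m ≥ n₀, ∀ n ≥ n₀,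
        |(∑ i, g q (e m i)) / Fintype.card (ι m) - (∑ i, g q (e n i)) / Fintype.card (ι n)|
          < ε / 8 := (Finset.eventually_all _).2 fun q _ => hcau q
    obtain ⟨n₁, hn₁⟩ := eventually_atTop.1 hΛ
    obtain ⟨n₀, hn₀, hn₀₁⟩ := (hall.and (eventually_ge_atTop n₁)).exists
    refine ⟨n₀, fun m hm n hn t _ => ?_⟩
    rw [Real.dist_eq]
    by_cases hlow : t < -C - 1
    · rw [empiricalCDF_eq_zero, empiricalCDF_eq_zero, sub_self, abs_zero]
      · exact hε
      · exact fun i => by linarith [(abs_le.1 (hC n i)).1]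
      · exact fun i => by linarith [(abs_le.1 (hC m i)).1]
    by_cases hhigh : C + 1 ≤ t
    · rw [empiricalCDF_eq_one, empiricalCDF_eq_one, sub_self, abs_zero]
      · exact hε
      · exact fun i => by linarith [(abs_le.1 (hC n i)).2]
      · exact fun i => by linarith [(abs_le.1 (hC m i)).2]
    rw [not_lt] at hlow
    rw [not_le] at hhigh
    have hne₁ : (Λ'.filter (· ≤ t)).Nonempty := ⟨-C - 1, by simp [Λ', hlow]⟩
    have hne₂ : (Λ'.filter (t < ·)).Nonempty := ⟨C + 1, by simp [Λ', hhigh]⟩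
    obtain ⟨a, ha, hamax⟩ := Finset.exists_max_image _ id hne₁
    obtain ⟨b, hb, hbmin⟩ := Finset.exists_min_image _ id hne₂
    simp only [id] at hamax hbmin
    rw [Finset.mem_filter] at ha hb
    have hab : a < b := ha.2.trans_lt hb.2
    have hgapmem : ∀ s, a ≤ s → s < b → ∀ l ∈ Λ, l ≤ s ↔ l ≤ t := by
      intro s has hsb l hl
      have hl' : l ∈ Λ' := by simp [Λ', hl]
      constructor
      · intro hls
        by_contra! htl
        exact absurd (hbmin l (Finset.mem_filter.2 ⟨hl', htl⟩)) (not_le.2 (hls.trans_lt hsb))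
      · intro hlt
        exact (hamax l (Finset.mem_filter.2 ⟨hl', hlt⟩)).trans has
    have hnear : ∀ k ≥ n₁, |(∑ i, g (a, b) (e k i)) / Fintype.card (ι k) -
        empiricalCDF (e k) t| ≤ ε / 8 := by
      intro k hk
      have h1 := abs_le.1 (hn₁ k hk a t (hgapmem a le_rfl hab))
      have h2 := abs_le.1 (hn₁ k hk ((a + b) / 2) t (hgapmem _ (by linarith) (by linarith)))
      have hpos : 0 < (b - a) / 2 := by linarith
      have h3 : empiricalCDF (e k) a ≤ (∑ i, g (a, b) (e k i)) / Fintype.card (ι k) := by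
        refine empiricalCDF_le_average _ (fun x => le_max_left _ _) fun x hx => ?_
        refine le_max_of_le_right (le_min le_rfl ?_)
        rw [le_div_iff₀ hpos]
        simp only
        linarith
      have h4 : (∑ i, g (a, b) (e k i)) / Fintype.card (ι k) ≤
          empiricalCDF (e k) ((a + b) / 2) := by
        refine average_le_empiricalCDF _ (fun x => max_le zero_le_one (min_le_left _ _))
          fun x hx => max_le le_rfl ((min_le_right _ _).trans ?_)
        exact div_nonpos_of_nonpos_of_nonneg (by simp only; linarith) hpos.le
      rw [abs_le]
      constructor <;> linarith [h1.1, h1.2, h2.1, h2.2]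
    have h1 := abs_le.1 (hnear m (hn₀₁.trans hm))
    have h2 := abs_le.1 (hnear n (hn₀₁.trans hn))
    have h3 := abs_lt.1 (hn₀ (a, b) (Finset.mem_product.2 ⟨ha.1, hb.1⟩) m hm n hn)
    rw [abs_lt]
    constructor <;> linarith [h1.1, h1.2, h2.1, h2.2, h3.1, h3.2]
  have hpt : ∀ t, ∃ l, Tendsto (fun n => empiricalCDF (e n) t) atTop (𝓝 l) := fun t =>
    cauchySeq_tendsto_of_complete <| Metric.cauchySeq_iff.2 fun ε hε => by
      obtain ⟨n₀, hn₀⟩ := Metric.uniformCauchySeqOn_iff.1 hcauchy ε hε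
      exact ⟨n₀, fun m hm n hn => hn₀ m hm n hn t trivial⟩
  choose σ hσ using hpt
  have hunif : TendstoUniformly (fun n => empiricalCDF (e n)) σ atTop :=
    tendstoUniformlyOn_univ.1 (hcauchy.tendstoUniformlyOn_of_tendsto fun t _ => hσ t)
  refine ⟨σ, fun s t hst => ?_, fun t => ?_, hunif⟩
  · exact le_of_tendsto_of_tendsto' (hσ s) (hσ t) fun n => empiricalCDF_mono (e n) hst
  · refine continuousWithinAt_of_locally_uniform_approx_of_continuousWithinAt
      (Set.mem_Ici.2 le_rfl) fun u hu => ?_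
    obtain ⟨n, hn⟩ := (hunif u hu).exists
    exact ⟨_, self_mem_nhdsWithin, _, empiricalCDF_continuousWithinAt (e n) t, fun y _ => hn y⟩

end Sequence

/-! ### Moments of the finite volume approximations -/

theorem normalizedSpectralDistribution_eq {ι : Type*} [Fintype ι] [DecidableEq ι]
    {M : Matrix ι ι ℝ} (hM : M.IsHermitian) :
    normalizedSpectralDistribution hM = empiricalCDF hM.eigenvalues := by
  funext t
  unfold normalizedSpectralDistribution empiricalCDF
  rw [← Set.ncard_coe_finset]
  congr 3
  ext i
  simp only [Finset.coe_filter, Finset.mem_univ, true_and]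
  congr!

namespace Matrix

variable {ι : Type*} [Fintype ι] [DecidableEq ι] {M N : Matrix ι ι ℝ}

theorem IsHermitian.abs_empiricalCDF_sub_le (hM : M.IsHermitian) (hN : N.IsHermitian) (B : Set ι)
    (h : ∀ v : ι → ℝ, (∀ x ∈ B, v x = 0) → v ⬝ᵥ M *ᵥ v = v ⬝ᵥ N *ᵥ v) (t : ℝ) :
    |empiricalCDF hM.eigenvalues t - empiricalCDF hN.eigenvalues t| ≤
      (B.ncard : ℝ) / Fintype.card ι := by
  have hcard : ∀ e : ι → ℝ, {i | e i ≤ t}.ncard = (Finset.univ.filter fun i => e i ≤ t).card :=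
    fun e => by
      rw [← Set.ncard_coe_finset]
      simp
  unfold empiricalCDF
  rw [← sub_div, abs_div, Nat.abs_cast, hcard, hcard]
  refine div_le_div_of_nonneg_right ?_ (Nat.cast_nonneg _)
  have h1 := hM.card_eigenvalues_le_le hN B h t
  have h2 := hN.card_eigenvalues_le_le hM B (fun v hv => (h v hv).symm) t
  rw [abs_le]
  constructor
  · have : ((Finset.univ.filter fun i => hN.eigenvalues i ≤ t).card : ℝ) ≤
      (Finset.univ.filter fun i => hM.eigenvalues i ≤ t).card + B.ncard := by exact_mod_cast h2
    linarith
  · have : ((Finset.univ.filter fun i => hM.eigenvalues i ≤ t).card : ℝ) ≤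
      (Finset.univ.filter fun i => hN.eigenvalues i ≤ t).card + B.ncard := by exact_mod_cast h1
    linarith

theorem sum_abs_pow_le {C : ℝ} (hC : ∀ x, ∑ y, |M x y| ≤ C) (k : ℕ) (x : ι) :
    ∑ y, |(M ^ k) x y| ≤ C ^ k := by
  induction k generalizing x with
  | zero =>
    rw [Finset.sum_eq_single x]
    · simp
    · intro y _ hy
      simp [Matrix.one_apply_ne hy.symm]
    · simp
  | succ k ih =>
    have hC0 : 0 ≤ C := (Finset.sum_nonneg fun _ _ => abs_nonneg _).trans (hC x)
    calc ∑ y, |(M ^ (k + 1)) x y| ≤ ∑ y, ∑ z, |M x z| * |(M ^ k) z y| := by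
          refine Finset.sum_le_sum fun y _ => ?_
          rw [pow_succ', Matrix.mul_apply]
          simp_rw [← abs_mul]
          exact Finset.abs_sum_le_sum_abs _ _
      _ = ∑ z, |M x z| * ∑ y, |(M ^ k) z y| := by
          rw [Finset.sum_comm]
          simp_rw [Finset.mul_sum]
      _ ≤ ∑ z, |M x z| * C ^ k := by
          gcongr with z
          exact ih z
      _ ≤ C ^ (k + 1) := by
          rw [← Finset.sum_mul, pow_succ']
          gcongr
          exact hC x

end Matrix

namespace XSGraph

variable {V X S : Type*} {G : XSGraph V X S} {A : Matrix V V ℝ} {s d : ℕ}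

theorem IsLocalKernel.exists_abs_le [Finite X] [Finite S] (hA : G.IsLocalKernel s A)
    (hG : G.DegreeBound d) : ∃ c : ℝ, 0 ≤ c ∧ ∀ x y, |A x y| ≤ c := by
  obtain ⟨E, hE⟩ := hA.finite_entries hG
  obtain ⟨c, hc⟩ := (E.finite_toSet.image fun a => |a|).bddAbove
  refine ⟨max c 0, le_max_right _ _, fun x y => le_max_of_le_left ?_⟩
  exact hc ⟨_, hE x y, rfl⟩

theorem IsLocalKernel.exists_sum_abs_finiteVolume_le [Finite X] [Finite S]
    (hA : G.IsLocalKernel s A) (hG : G.DegreeBound d) :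
    ∃ C : ℝ, ∀ (W : Finset V) (x : (W : Set V)), ∑ y, |finiteVolume A W x y| ≤ C := by
  classical
  obtain ⟨c, hc0, hc⟩ := hA.exists_abs_le hG
  refine ⟨((d + 1) ^ s : ℕ) * c, fun W x => ?_⟩
  let T : Finset (W : Set V) := Finset.univ.filter fun y => (y : V) ∈ G.ballSet (x : V) s
  have hT : T.card ≤ (d + 1) ^ s := by
    refine le_trans ?_ (hG.ncard_ballSet_le (x : V) s)
    rw [← Finset.card_image_of_injective T Subtype.val_injective, ← Set.ncard_coe_finset]
    refine Set.ncard_le_ncard ?_ (hG.finite_ballSet _ _)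
    intro y hy
    simp only [T, Finset.coe_image, Finset.coe_filter] at hy
    obtain ⟨z, hz, rfl⟩ := hy
    exact hz.2
  calc ∑ y, |finiteVolume A W x y| = ∑ y ∈ T, |finiteVolume A W x y| := by
        refine (Finset.sum_subset (Finset.subset_univ _) fun y _ hy => ?_).symm
        have h0 : A x y = 0 := hA.eq_zero _ _ fun h => hy (by simp [T, h])
        exact abs_eq_zero.2 h0
    _ ≤ T.card * c := by
        rw [← nsmul_eq_mul]
        exact Finset.sum_le_card_nsmul _ _ _ fun y _ => hc _ _
    _ ≤ ((d + 1) ^ s : ℕ) * c := by gcongr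

/-- The moments converge: up to the points near the boundary, the trace of a power of the finite
volume approximation is a sum over the vertices of a function of the pattern around the vertex. -/
theorem IsFolnerSequence.exists_tendsto_trace_pow [Finite X] [Finite S] {W : ℕ → Finset V}
    (hW : G.IsFolnerSequence W) (hG : G.DegreeBound d)
    (hconv : WeaklyConvergent d (G.inducedSequence W)) (hA : G.IsLocalKernel s A)
    [∀ n, DecidableEq (W n : Set V)] (k : ℕ) :
    ∃ L, Tendsto (fun n => (finiteVolume A (W n) ^ k).trace / Fintype.card (W n : Set V))
      atTop (𝓝 L) := by
  have hP := hA.kernelPow hG k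
  obtain ⟨L, hL⟩ := hW.tendsto_average hG hconv (r := k * s + 1) (by omega)
    (f := fun x => kernelPow A k x x) fun x x' g hg => by
      rw [hP.map_eq x x' g (hg.root (by omega)) x (self_mem_ballSet _ _ _), hg.map_root]
  obtain ⟨c, hc0, hc⟩ := hP.exists_abs_le hG
  obtain ⟨C, hC⟩ := hA.exists_sum_abs_finiteVolume_le hG
  refine ⟨L, ?_⟩
  have hcard : ∀ n, (Fintype.card ((W n : Set V)) : ℝ) = (W n).card := by simp
  have hdiff : Tendsto (fun n => (finiteVolume A (W n) ^ k).trace / Fintype.card (W n : Set V) -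
      (∑ x ∈ W n, kernelPow A k x x) / (W n).card) atTop (𝓝 0) := by
    have h0 := (hW.tendsto_near hG (k * s)).mul_const (C ^ k + c)
    rw [zero_mul] at h0
    refine squeeze_zero_norm (fun n => ?_) h0
    classical
    rw [hcard, ← sub_div, Real.norm_eq_abs, abs_div, Nat.abs_cast, div_mul_eq_mul_div]
    refine div_le_div_of_nonneg_right ?_ (Nat.cast_nonneg _)
    rw [Matrix.trace, Finset.sum_subtype (W n) (p := (· ∈ (W n : Set V))) (fun _ => Iff.rfl),
      ← Finset.sum_sub_distrib]
    refine (Finset.abs_sum_le_sum_abs _ _).trans ?_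
    let B := (G.near (W n) (k * s) (G.boundary (W n))).toFinset
    rw [← Finset.sum_subset (Finset.subset_univ B), Set.ncard_eq_toFinset_card', ← nsmul_eq_mul]
    · refine Finset.sum_le_card_nsmul _ _ _ fun x _ => (abs_sub _ _).trans (add_le_add ?_ (hc _ _))
      refine le_trans ?_ (Matrix.sum_abs_pow_le (hC (W n)) k x)
      exact Finset.single_le_sum (f := fun y => |(finiteVolume A (W n) ^ k) x y|)
        (fun _ _ => abs_nonneg _) (Finset.mem_univ x)
    · intro x _ hx
      rw [Set.mem_toFinset] at hx
      rw [abs_eq_zero, sub_eq_zero]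
      refine hA.finiteVolume_pow_apply (W n) k x x fun y hy => ?_
      exact (exists_walk_induce x.2 (fun z hz hzB => hx ⟨z, hz, hzB⟩) hy).1
  simpa using hL.add hdiff

/-! ### Cutting along a hyperfinite decomposition -/

theorem ncard_edgeSet_le {U : Type*} [Fintype U] (H : SimpleGraph U)
    (hH : ∀ x, (H.neighborSet x).encard ≤ d) : H.edgeSet.ncard ≤ Fintype.card U * d := by
  have hcover : H.edgeSet ⊆ ⋃ x ∈ Finset.univ, (fun y => s(x, y)) '' H.neighborSet x := by
    intro e
    induction e with
    | h x y =>
      intro h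
      exact Set.mem_biUnion (Finset.mem_coe.2 (Finset.mem_univ x)) ⟨y, h, rfl⟩
  refine (Set.ncard_le_ncard hcover (Set.toFinite _)).trans ?_
  refine (Finset.set_ncard_biUnion_le _ _).trans ?_
  refine Finset.sum_le_card_nsmul _ _ _ fun x _ => (Set.ncard_image_le (Set.toFinite _)).trans ?_
  have := hH x
  rw [← (Set.toFinite (H.neighborSet x)).cast_ncard_eq] at this
  exact_mod_cast this

theorem ncard_endpoints_le {U : Type*} [Fintype U] (F : Set (Sym2 U)) :
    {z | ∃ e ∈ F, z ∈ e}.ncard ≤ 2 * F.ncard := by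
  classical
  have hF := Set.toFinite F
  have hcover : {z | ∃ e ∈ F, z ∈ e} ⊆ ⋃ e ∈ hF.toFinset, {z | z ∈ e} := by
    rintro z ⟨e, he, hz⟩
    exact Set.mem_biUnion (by simpa using he) hz
  refine (Set.ncard_le_ncard hcover (Set.toFinite _)).trans ?_
  refine (Finset.set_ncard_biUnion_le _ _).trans ?_
  rw [Set.ncard_eq_toFinset_card _ hF, mul_comm]
  refine Finset.sum_le_card_nsmul _ _ _ fun e _ => ?_
  induction e with
  | h x y =>
    have : {z | z ∈ s(x, y)} = {x, y} := by ext; simp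
    rw [this]
    exact (Set.ncard_insert_le _ _).trans (by rw [Set.ncard_singleton])

theorem DegreeBound.induce (hG : G.DegreeBound d) (W : Set V) : (G.induce W).DegreeBound d := by
  intro x
  refine le_trans ?_ (hG x)
  rw [← Subtype.val_injective.encard_image]
  refine Set.encard_le_encard ?_
  rintro _ ⟨y, hy, rfl⟩
  exact hy

/-- The restriction of the kernel to the points of `W` that do not lie in `B`, extended by zero. -/
noncomputable def cutFiniteVolume (A : Matrix V V ℝ) (W : Finset V) (B : Set (W : Set V)) :
    Matrix (W : Set V) (W : Set V) ℝ :=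
  fun x y => Bᶜ.indicator (fun x => Bᶜ.indicator (finiteVolume A W x) y) x

theorem cutFiniteVolume_apply_of_notMem (W : Finset V) {B : Set (W : Set V)} {x y : (W : Set V)}
    (hx : x ∉ B) (hy : y ∉ B) : cutFiniteVolume A W B x y = A x y := by
  rw [cutFiniteVolume, Set.indicator_of_mem hx, Set.indicator_of_mem hy]
  rfl

theorem cutFiniteVolume_apply_left (W : Finset V) {B : Set (W : Set V)} {x : (W : Set V)}
    (hx : x ∈ B) (y : (W : Set V)) : cutFiniteVolume A W B x y = 0 := by
  rw [cutFiniteVolume, Set.indicator_of_notMem (Set.notMem_compl_iff.2 hx)]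

theorem cutFiniteVolume_apply_right (W : Finset V) {B : Set (W : Set V)} (x : (W : Set V))
    {y : (W : Set V)} (hy : y ∈ B) : cutFiniteVolume A W B x y = 0 := by
  by_cases hx : x ∈ B
  · exact cutFiniteVolume_apply_left W hx y
  · rw [cutFiniteVolume, Set.indicator_of_mem hx,
      Set.indicator_of_notMem (Set.notMem_compl_iff.2 hy)]

theorem cutFiniteVolume_isHermitian (hA : A.IsHermitian) (W : Finset V) (B : Set (W : Set V)) :
    (cutFiniteVolume A W B).IsHermitian := by
  refine Matrix.IsHermitian.ext fun x y => ?_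
  rw [star_trivial]
  by_cases hx : x ∈ B
  · rw [cutFiniteVolume_apply_left W hx, cutFiniteVolume_apply_right W y hx]
  by_cases hy : y ∈ B
  · rw [cutFiniteVolume_apply_left W hy, cutFiniteVolume_apply_right W x hy]
  rw [cutFiniteVolume_apply_of_notMem W hx hy, cutFiniteVolume_apply_of_notMem W hy hx]
  simpa using hA.apply x y

open Matrix in
theorem dotProduct_cutFiniteVolume (W : Finset V) {B : Set (W : Set V)} {v : ↥(W : Set V) → ℝ}
    (hv : ∀ x ∈ B, v x = 0) :
    v ⬝ᵥ finiteVolume A W *ᵥ v = v ⬝ᵥ cutFiniteVolume A W B *ᵥ v := by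
  simp only [dotProduct, mulVec]
  refine Finset.sum_congr rfl fun x _ => ?_
  by_cases hx : x ∈ B
  · simp [hv x hx]
  congr 1
  refine Finset.sum_congr rfl fun y _ => ?_
  by_cases hy : y ∈ B
  · simp [hv y hy]
  rw [cutFiniteVolume_apply_of_notMem W hx hy]
  rfl

/-- A vertex far from the boundary of `W` and from the removed edges lies in the same component
as all vertices of its ball. -/
theorem reachable_deleteEdges {W : Set V} {F : Set (Sym2 W)} {r : ℕ} {x y : W}
    (hx : x ∉ G.near W r (G.boundary W ∪ Subtype.val '' {z : W | ∃ e ∈ F, z ∈ e}))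
    (hy : (y : V) ∈ G.ballSet (x : V) r) :
    ((G.induce W).graph.deleteEdges F).Reachable x y := by
  obtain ⟨_, p, -, hp⟩ := exists_walk_induce x.2
    (fun z hz hzB => hx ⟨z, hz, Or.inl hzB⟩) hy
  have hpF : ∀ e ∈ p.edges, e ∉ F := by
    intro e
    induction e with
    | h u v =>
      intro he heF
      refine hx ⟨u, hp u (p.fst_mem_support_of_mem_edges he), Or.inr ⟨u, ⟨_, heF, ?_⟩, rfl⟩⟩
      exact Sym2.mem_mk_left u v
  exact (p.toDeleteEdges F hpF).reachable

/-- Hyperfiniteness: up to a small uniform error the spectral distribution functions of the finite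
volume approximations have all their jumps in one finite set. -/
theorem IsFolnerSequence.exists_finset_gap [Finite X] [Finite S] {W : ℕ → Finset V}
    (hW : G.IsFolnerSequence W) (hG : G.DegreeBound d)
    (hanti : Antiexpander (G.inducedSequence W)) (hA : A.IsHermitian) (hloc : G.IsLocalKernel s A)
    [∀ n, DecidableEq (W n : Set V)] {ε : ℝ} (hε : 0 < ε) :
    ∃ Λ : Finset ℝ, ∀ᶠ n in atTop, ∀ t u : ℝ, (∀ l ∈ Λ, l ≤ t ↔ l ≤ u) →
      |empiricalCDF (finiteVolume_isHermitian hA (W n)).eigenvalues t -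
        empiricalCDF (finiteVolume_isHermitian hA (W n)).eigenvalues u| ≤ ε := by
  classical
  set D : ℕ := (d + 1) ^ s with hD
  have hD0 : (0 : ℝ) < D := by rw [hD]; positivity
  have hd0 : (0 : ℝ) < d + 1 := by positivity
  -- Removing at most `δ |E|` edges makes at most `2 δ d D |W| ≤ ε |W| / 4` vertices bad.
  set δ : ℝ := ε / (8 * (d + 1) * D) with hδ
  obtain ⟨K, -, hK⟩ := hanti δ (by positivity)
  obtain ⟨E, hE⟩ := hloc.finite_entries hG
  obtain ⟨Λ, hΛ⟩ := Matrix.exists_finset_eigenvalues_mem (insert 0 E) K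
  refine ⟨Λ, ?_⟩
  have hbd : ∀ᶠ n in atTop,
      ((G.boundary (W n)).ncard : ℝ) / (W n).card < ε / (4 * D) :=
    hW.tendsto_boundary.eventually_lt_const (by positivity)
  filter_upwards [hbd] with n hn t u htu
  obtain ⟨F, -, hFcard, hFK⟩ := hK n
  have hcard : Fintype.card (W n : Set V) = (W n).card := by simp
  have hpos : (0 : ℝ) < (W n).card := by exact_mod_cast hW.card_pos n
  let B₀ : Set V := G.boundary (W n) ∪ Subtype.val '' {z : (W n : Set V) | ∃ e ∈ F, z ∈ e}
  let B : Set (W n : Set V) := G.near (W n) s B₀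
  have hBcard : (B.ncard : ℝ) / Fintype.card (W n : Set V) ≤ ε / 2 := by
    have hfin : B₀.Finite := ((W n).finite_toSet.subset (G.boundary_subset _)).union
      ((Set.toFinite _).image _)
    have h1 : B.ncard ≤ B₀.ncard * D := hG.ncard_near_le _ s hfin
    have h2 : B₀.ncard ≤ (G.boundary (W n)).ncard + 2 * F.ncard :=
      (Set.ncard_union_le _ _).trans (add_le_add le_rfl
        ((Set.ncard_image_le (Set.toFinite _)).trans (ncard_endpoints_le F)))
    have h3 : (F.ncard : ℝ) ≤ δ * ((W n).card * d) := by
      refine hFcard.trans ?_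
      have := ncard_edgeSet_le (G.induce (W n)).graph (hG.induce (W n : Set V))
      rw [hcard] at this
      refine mul_le_mul_of_nonneg_left ?_ (by positivity)
      exact_mod_cast this
    have h4 : (B.ncard : ℝ) ≤ ((G.boundary (W n)).ncard + 2 * F.ncard) * D := by
      exact_mod_cast h1.trans (by gcongr)
    rw [div_lt_iff₀ hpos] at hn
    rw [hcard, div_le_iff₀ hpos]
    have h5 : ((G.boundary (W n)).ncard : ℝ) * D ≤ ε / 4 * (W n).card := by
      calc ((G.boundary (W n)).ncard : ℝ) * D ≤ (ε / (4 * D) * (W n).card) * D := by gcongr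
        _ = ε / 4 * (W n).card := by field_simp
    have h6 : 2 * (F.ncard : ℝ) * D ≤ ε / 4 * (W n).card := by
      calc 2 * (F.ncard : ℝ) * D ≤ 2 * (δ * ((W n).card * (d + 1))) * D := by
            gcongr
            exact h3.trans (by gcongr; linarith)
        _ = ε / 4 * (W n).card := by rw [hδ]; field_simp; ring
    linarith
  have hcut := cutFiniteVolume_isHermitian hA (W n) B
  have hnear := (finiteVolume_isHermitian hA (W n)).abs_empiricalCDF_sub_le hcut B
    fun v hv => dotProduct_cutFiniteVolume (W n) hv
  have hmem : ∀ i, hcut.eigenvalues i ∈ Λ := by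
    refine hΛ ((G.inducedSequence W n).graph.deleteEdges F).connectedComponentMk _ hcut ?_ ?_ ?_
    · intro x y
      by_cases hx : x ∈ B
      · rw [cutFiniteVolume_apply_left _ hx]; exact Finset.mem_insert_self _ _
      by_cases hy : y ∈ B
      · rw [cutFiniteVolume_apply_right _ x hy]; exact Finset.mem_insert_self _ _
      rw [cutFiniteVolume_apply_of_notMem _ hx hy]
      exact Finset.mem_insert_of_mem (hE _ _)
    · intro x y hxy
      have hx : x ∉ B := fun hx => hxy (cutFiniteVolume_apply_left _ hx y)
      have hy : y ∉ B := fun hy => hxy (cutFiniteVolume_apply_right _ x hy)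
      rw [cutFiniteVolume_apply_of_notMem _ hx hy] at hxy
      have hball : (y : V) ∈ G.ballSet (x : V) s := by
        by_contra h
        exact hxy (hloc.eq_zero _ _ h)
      exact SimpleGraph.ConnectedComponent.eq.2 (reachable_deleteEdges hx hball)
    · exact fun x => hFK _
  have hconst : empiricalCDF hcut.eigenvalues t = empiricalCDF hcut.eigenvalues u :=
    empiricalCDF_congr _ fun i => htu _ (hmem i)
  have h1 := abs_le.1 ((hnear t).trans hBcard)
  have h2 := abs_le.1 ((hnear u).trans hBcard)
  rw [abs_le]
  constructor <;> linarith [h1.1, h1.2, h2.1, h2.2]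

/-! ### The integrated density of states -/

theorem IsFolnerSequence.exists_tendstoUniformly [Finite X] [Finite S] {W : ℕ → Finset V}
    (hW : G.IsFolnerSequence W) (hG : G.DegreeBound d)
    (hconv : WeaklyConvergent d (G.inducedSequence W))
    (hanti : Antiexpander (G.inducedSequence W)) (hA : A.IsHermitian) (hloc : G.IsLocalKernel s A) :
    ∃ σ : ℝ → ℝ, Monotone σ ∧ (∀ t, ContinuousWithinAt σ (Set.Ici t) t) ∧
      TendstoUniformly
        (fun n => normalizedSpectralDistribution (finiteVolume_isHermitian hA (W n))) σ atTop := by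
  classical
  have : ∀ n, Nonempty (W n : Set V) := fun n => (hW.connected n).nonempty
  obtain ⟨C, hC⟩ := hloc.exists_sum_abs_finiteVolume_le hG
  simp_rw [normalizedSpectralDistribution_eq]
  refine exists_tendstoUniformly_empiricalCDF (C := C)
    (fun n i => (finiteVolume_isHermitian hA (W n)).abs_eigenvalues_le (hC (W n)) i)
    (fun k => ?_) fun ε hε => hW.exists_finset_gap hG hanti hA hloc hε
  simp_rw [Matrix.IsHermitian.sum_eigenvalues_pow]
  exact hW.exists_tendsto_trace_pow hG hconv hloc k

/-- The alternating sequence of two Følner sequences is a Følner sequence. -/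
theorem IsFolnerSequence.interleave {W W' : ℕ → Finset V} (hW : G.IsFolnerSequence W)
    (hW' : G.IsFolnerSequence W') :
    G.IsFolnerSequence fun n => if Even n then W (n / 2) else W' (n / 2) where
  connected n := by
    by_cases h : Even n
    · exact (congrArg (fun U : Finset V => (G.graph.induce (U : Set V)).Connected)
        (if_pos h)).mpr (hW.connected (n / 2))
    · exact (congrArg (fun U : Finset V => (G.graph.induce (U : Set V)).Connected)
        (if_neg h)).mpr (hW'.connected (n / 2))
  tendsto_boundary := by
    have hdiv : Tendsto (fun n : ℕ => n / 2) atTop atTop :=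
      Nat.tendsto_div_const_atTop (by norm_num)
    refine ((hW.tendsto_boundary.comp hdiv).if' (p := Even)
      (hW'.tendsto_boundary.comp hdiv)).congr fun n => ?_
    split_ifs <;> rfl

end XSGraph

theorem mainTheorem1 {V X S : Type*} [Infinite V] [Finite X] [Finite S]
    (G : XSGraph V X S) (d : ℕ)
    (hconn : G.graph.Connected)
    (hdeg : G.DegreeBound d)
    (hUPF : G.UniformPatchFrequency d)
    (hanti : ∀ W : ℕ → Finset V, G.IsFolnerSequence W →
      XSGraph.Antiexpander (G.inducedSequence W))
    (A : Matrix V V ℝ) (hA : A.IsHermitian) (hinv : G.IsPatternInvariant A) :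
    ∃ σ : ℝ → ℝ, Monotone σ ∧ (∀ t, ContinuousWithinAt σ (Set.Ici t) t) ∧
      ∀ W : ℕ → Finset V, G.IsFolnerSequence W →
        TendstoUniformly
          (fun n => normalizedSpectralDistribution (finiteVolume_isHermitian hA (W n)))
          σ atTop := by
  obtain ⟨s, hloc⟩ := hinv.exists_isLocalKernel
  have hlim : ∀ W : ℕ → Finset V, G.IsFolnerSequence W → _ := fun W hW =>
    hW.exists_tendstoUniformly hdeg (hUPF.2 W hW) (hanti W hW) hA hloc
  obtain ⟨W₀, hW₀⟩ := hUPF.1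
  obtain ⟨σ, hmono, hcont, hσ⟩ := hlim W₀ hW₀
  refine ⟨σ, hmono, hcont, fun W hW => ?_⟩
  obtain ⟨τ, -, -, hτ⟩ := hlim W hW
  -- The alternating sequence converges, so its two halves have the same limit.
  obtain ⟨ρ, -, -, hρ⟩ := hlim _ (hW₀.interleave hW)
  suffices h : τ = σ from h ▸ hτ
  funext t
  let N : Finset V → ℝ := fun U => normalizedSpectralDistribution (finiteVolume_isHermitian hA U) t
  have heven : Tendsto (fun n : ℕ => 2 * n) atTop atTop :=
    tendsto_id.const_mul_atTop' (by norm_num)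
  have hodd : Tendsto (fun n : ℕ => 2 * n + 1) atTop atTop :=
    (tendsto_add_atTop_nat 1).comp heven
  have hρσ : ρ t = σ t := by
    refine tendsto_nhds_unique (((hρ.tendsto_at t).comp heven).congr fun n => ?_) (hσ.tendsto_at t)
    refine congrArg N (a₂ := W₀ n) ?_
    change (if Even (2 * n) then W₀ (2 * n / 2) else W (2 * n / 2)) = W₀ n
    rw [if_pos (even_two_mul n), Nat.mul_div_cancel_left n two_pos]
  have hρτ : ρ t = τ t := by
    refine tendsto_nhds_unique (((hρ.tendsto_at t).comp hodd).congr fun n => ?_) (hτ.tendsto_at t)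
    refine congrArg N (a₂ := W n) ?_
    change (if Even (2 * n + 1) then W₀ ((2 * n + 1) / 2) else W ((2 * n + 1) / 2)) = W n
    rw [if_neg (Nat.not_even_two_mul_add_one n)]
    congr 1
    omega
  rw [← hρσ, ← hρτ]
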